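/- Let $g\ge 2$ and $N\ge 2$. Let $\Gamma\subset \mathrm{SL}_2(\mathbb C)$ be a marked Schottky group of genus $g$: it is generated by $\gamma_1,\dots,\gamma_g$, where $\mathcal C_{\pm1},\dots,\mathcal C_{\pm g}$ are Jordan curves in $\mathbb C$ bounding pairwise disjoint closed discs and $\gamma_a$ maps $\mathcal C_a$ onto $\mathcal C_{-a}$ and the exterior of $\mathcal C_a$ in $\widehat{\mathbb C}=\mathbb C\cup\{\infty\}$ onto the interior of $\mathcal C_{-a}$. Let $\Omega_0=\widehat{\mathbb C}\setminus\Lambda(\Gamma)$ be the complement of the limit set, $\mathcal S=\Omega_0/\Gamma$ the corresponding compact Riemann surface of genus $g$, $\mathcal D$ a fundamental region, and $\rho(z)\,dz\,d\bar z$ the Poincaré metric of $\mathcal S$ lifted to $\Omega_0$ (induced from $y^{-2}d\zeta\, d\bar\zeta$, $\zeta=x+iy$, on the upper half plane by uniformization). Let $\mathcal H_N$ be the space of holomorphic $N$-differentials on $\mathcal S$ with the Petersson product $$\langle \phi\,dz^N,\theta\,dz^N\rangle=\iint_{\mathcal D}\phi\,\overline{\theta}\,\rho^{1-N}\,d^2z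 ,\qquad d^2z=\tfrac{i}{2}\,dz\wedge d\bar z,$$ and put $$p_N(x,y)=\sum_{r}\phi_r^{\vee}(x)\,\overline{\phi_r(y)}\,\rho(y)^{1-N},$$ where $\{\phi_r\,dz^N\}$ is any basis of $\mathcal H_N$ and $\{\phi_r^{\vee}\,dz^N\}$ its Petersson dual basis, $\langle \phi^\vee_r dz^N,\phi_s dz^N\rangle=\delta_{rs}$. A Green's function for $\overline\partial_N$ is a bidifferential $(N,1-N)$-form $G_N(x,y)=g_N(x,y)\,dx^N dy^{1-N}$, defined for $x,y\in\Omega_0$ with $y\notin\Gamma x$, so that $g_N(\gamma x,y)\,(d\gamma x/dx)^N=g_N(x,y)$ and $g_N(x,\gamma y)\,(d\gamma y/dy)^{1-N}=g_N(x,y)$ for all $\gamma\in\Gamma$, whose regular part $$g_N^R(x,y)=g_N(x,y)-\frac1{x-y}$$ extends to all finite $x,y\in\Omega_0$ with $y\ne\gamma x$ for every $\gamma\in\Gamma\setminus\{1\}$ (in particular to $x=y$) in such a way that there (I) $g_N^R(x,y)$ is holomorphic in $x$; (II) $g_N^R(x,y)$ is real differentiable in $y$ and $\dfrac1\pi\,\dfrac{\partial}{\partial\bar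 y}\,g_N^R(x,y)=p_N(x,y)$. Then the Green's function is unique: if $G_N$ and $\widetilde G_N$ are two Green's functions for $\overline\partial_N$, then $G_N(x,y)=\widetilde G_N(x,y)$ for all $x,y\in\Omega_0$ with $y\notin\Gamma x$. -/

import Mathlib

open scoped MatrixGroups UpperHalfPlane ContDiff

noncomputable section

/-- The Möbius action of `SL(2, ℂ)` on the Riemann sphere `ℂ ∪ {∞}`. -/
def sphereMap (γ : SL(2, ℂ)) (z : OnePoint ℂ) : OnePoint ℂ :=
  (γ : GL (Fin 2) ℂ) • z

/-- The denominator `c z + d`; the derivative of `z ↦ γ z` is `(c z + d)⁻²`. -/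
def moebiusDenom (γ : SL(2, ℂ)) (z : ℂ) : ℂ :=
  γ 1 0 * z + γ 1 1

/-- The value `γ z = (a z + b) / (c z + d)` at a finite point `z` with `c z + d ≠ 0`. -/
def moebiusMap (γ : SL(2, ℂ)) (z : ℂ) : ℂ :=
  (γ 0 0 * z + γ 0 1) / moebiusDenom γ z

/-- The inside of a closed curve `C` in the plane: the union of the bounded components of the
complement of `C`. -/
def curveInside (C : Set ℂ) : Set ℂ :=
  {z | z ∉ C ∧ Bornology.IsBounded (connectedComponentIn Cᶜ z)}

/-- The closed disc bounded by a closed curve `C`. -/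
def curveDisc (C : Set ℂ) : Set ℂ :=
  C ∪ curveInside C

/-- A marked Schottky group of genus `g`: Jordan curves `C_a` (index `(a, true)`) and `C_{-a}`
(index `(a, false)`) in the plane, bounding pairwise disjoint closed discs, together with Möbius
generators `γ_a` that map `C_a` onto `C_{-a}` and the exterior of `C_a` on the sphere onto the
inside of `C_{-a}`. Such a `γ_a` is loxodromic, and its fixed points `W_{±a}` and its multiplier
`q_a` are the Schottky parameters. -/
structure SchottkyGroup (g : ℕ) where
  curve : Fin g × Bool → Circle → ℂ
  curve_continuous : ∀ i, Continuous (curve i)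
  curve_injective : ∀ i, Function.Injective (curve i)
  disc_disjoint : ∀ i j, i ≠ j →
    Disjoint (curveDisc (Set.range (curve i))) (curveDisc (Set.range (curve j)))
  gen : Fin g → SL(2, ℂ)
  gen_curve : ∀ a,
    sphereMap (gen a) '' ((fun z : ℂ => (z : OnePoint ℂ)) '' Set.range (curve (a, true))) =
      (fun z : ℂ => (z : OnePoint ℂ)) '' Set.range (curve (a, false))
  gen_exterior : ∀ a,
    sphereMap (gen a) ''
        ((fun z : ℂ => (z : OnePoint ℂ)) '' curveDisc (Set.range (curve (a, true))))ᶜ =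
      (fun z : ℂ => (z : OnePoint ℂ)) '' curveInside (Set.range (curve (a, false)))

namespace SchottkyGroup

/-- The group `Γ` generated by the `γ_a`. -/
def group {g : ℕ} (S : SchottkyGroup g) : Subgroup SL(2, ℂ) :=
  Subgroup.closure (Set.range S.gen)

/-- The limit set of `Γ`: all limits of sequences `γ_n z` with pairwise distinct `γ_n ∈ Γ`. -/
def limitSet {g : ℕ} (S : SchottkyGroup g) : Set (OnePoint ℂ) :=
  {w | ∃ (z : OnePoint ℂ) (γ : ℕ → SL(2, ℂ)), Function.Injective γ ∧ (∀ n, γ n ∈ S.group) ∧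
    Filter.Tendsto (fun n => sphereMap (γ n) z) Filter.atTop (nhds w)}

/-- The region of discontinuity `Ω₀ = (ℂ ∪ {∞}) ∖ Λ(Γ)`; the Riemann surface is `Ω₀ / Γ`. -/
def sphereDomain {g : ℕ} (S : SchottkyGroup g) : Set (OnePoint ℂ) :=
  S.limitSetᶜ

/-- The finite points of `Ω₀`. A form on `Ω₀` is given below by its coefficient on these points
(in the coordinate `z`). For `g ≥ 1` the point `∞ ∈ Ω₀` is moved by `Γ` to a finite point of `Ω₀`,
so the behaviour of an automorphic form at `∞` is determined by its behaviour at finite points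
and needs no separate condition. -/
def domain {g : ℕ} (S : SchottkyGroup g) : Set ℂ :=
  {z | (z : OnePoint ℂ) ∈ S.sphereDomain}

/-- The (finite part of the) fundamental set: the common exterior of all the curves together with
the curves `C_1, …, C_g`. It has exactly one point of every `Γ`-orbit in `Ω₀`, except that
`∞` itself is left out. -/
def fundamentalSet {g : ℕ} (S : SchottkyGroup g) : Set ℂ :=
  (⋃ i, curveDisc (Set.range (S.curve i)))ᶜ ∪ ⋃ a, Set.range (S.curve (a, true))

/-- `ρ(z) dz dz̄` is the Poincaré metric of `Ω₀ / Γ`, lifted to `Ω₀`: a smooth positive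
`Γ`-invariant `(1, 1)`-form whose pull-back under a holomorphic universal covering
`π : ℍ → Ω₀` (hence `ℍ → Ω₀ / Γ`) is `(Im τ)⁻² dτ dτ̄`. -/
structure IsPoincareMetric {g : ℕ} (S : SchottkyGroup g) (ρ : ℂ → ℝ) : Prop where
  pos : ∀ z ∈ S.domain, 0 < ρ z
  smooth : ContDiffOn ℝ ∞ ρ S.domain
  invariant : ∀ γ ∈ S.group, ∀ z ∈ S.domain, moebiusDenom γ z ≠ 0 →
    ρ (moebiusMap γ z) * ‖moebiusDenom γ z‖ ^ (-4 : ℤ) = ρ z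
  uniformization : ∃ π : ℍ → OnePoint ℂ,
    IsCoveringMapOn π S.sphereDomain ∧ Set.range π = S.sphereDomain ∧
    ∀ (τ : ℍ) (w : ℂ), π τ = (w : OnePoint ℂ) →
      ∃ c : ℂ, HasDerivAt
          (fun t : ℂ => (π (UpperHalfPlane.ofComplex t)).elim (0 : ℂ) id) c (τ : ℂ) ∧
        ρ w * ‖c‖ ^ 2 = τ.im ^ (-2 : ℤ)

/-- The space of holomorphic `k`-differentials `φ(z) dzᵏ` on `Ω₀ / Γ`, given by coefficients `φ`
on the finite part of `Ω₀` (normalized to be `0` elsewhere). -/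
def holomorphicForms {g : ℕ} (S : SchottkyGroup g) (k : ℤ) : Submodule ℂ (ℂ → ℂ) where
  carrier := {φ | (∀ z ∈ S.domain, DifferentiableAt ℂ φ z) ∧
    (∀ γ ∈ S.group, ∀ z ∈ S.domain, moebiusDenom γ z ≠ 0 →
      φ (moebiusMap γ z) * moebiusDenom γ z ^ (-2 * k) = φ z) ∧
    ∀ z ∉ S.domain, φ z = 0}
  add_mem' := by
    rintro φ ψ ⟨h1, h2, h3⟩ ⟨k1, k2, k3⟩
    refine ⟨fun z hz => (h1 z hz).add (k1 z hz), fun γ hγ z hz hd => ?_, fun z hz => ?_⟩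
    · simp only [Pi.add_apply, add_mul, h2 γ hγ z hz hd, k2 γ hγ z hz hd]
    · simp only [Pi.add_apply, h3 z hz, k3 z hz, add_zero]
  zero_mem' := by
    refine ⟨fun z _ => differentiableAt_const 0, fun γ _ z _ _ => ?_, fun z _ => rfl⟩
    simp only [Pi.zero_apply, zero_mul]
  smul_mem' := by
    rintro c φ ⟨h1, h2, h3⟩
    refine ⟨fun z hz => (h1 z hz).const_smul c, fun γ hγ z hz hd => ?_, fun z hz => ?_⟩
    · simp only [Pi.smul_apply, smul_eq_mul, mul_assoc, h2 γ hγ z hz hd]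
    · simp only [Pi.smul_apply, h3 z hz, smul_zero]

/-- The Petersson product `∬ φ θ̄ ρ^{1-N} d²z` of two `N`-differentials. -/
def petersson {g : ℕ} (S : SchottkyGroup g) (ρ : ℂ → ℝ) (N : ℕ) (φ θ : ℂ → ℂ) : ℂ :=
  ∫ z in S.fundamentalSet,
    φ z * (starRingEnd ℂ) (θ z) * ((ρ z ^ (1 - (N : ℤ)) : ℝ) : ℂ)

/-- `p` is the kernel `p_N(x, y) = ∑ᵣ φᵣ^∨(x) conj(φᵣ(y)) ρ(y)^{1-N}` of the projection onto
holomorphic `N`-differentials, for a basis `φᵣ` with Petersson dual basis `φᵣ^∨`. -/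
def IsProjectionKernel {g : ℕ} (S : SchottkyGroup g) (ρ : ℂ → ℝ) (N : ℕ)
    (p : ℂ → ℂ → ℂ) : Prop :=
  ∃ (d : ℕ) (φ φdual : Module.Basis (Fin d) ℂ (S.holomorphicForms N)),
    (∀ r s, S.petersson ρ N (φdual r) (φ s) = if r = s then 1 else 0) ∧
    ∀ x ∈ S.domain, ∀ y ∈ S.domain,
      p x y = ∑ r, (φdual r : ℂ → ℂ) x * (starRingEnd ℂ) ((φ r : ℂ → ℂ) y) *
        ((ρ y ^ (1 - (N : ℤ)) : ℝ) : ℂ)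

/-- The Wirtinger derivative `∂f/∂z̄ = (∂f/∂x + i ∂f/∂y) / 2`. -/
def wirtingerBar (f : ℂ → ℂ) (z : ℂ) : ℂ :=
  (1 / 2) * (fderiv ℝ f z 1 + Complex.I * fderiv ℝ f z Complex.I)

/-- `y` does not lie in the `Γ`-orbit of `x`, i.e. the corresponding points of `Ω₀ / Γ` differ. -/
def OffOrbit {g : ℕ} (S : SchottkyGroup g) (x y : ℂ) : Prop :=
  ∀ γ ∈ S.group, sphereMap γ x ≠ y

/-- `x, y` are finite points of `Ω₀` with `y ≠ γ x` for all `γ ∈ Γ ∖ {1}`. These pairs form an open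
set which contains the diagonal and `D × D` (`D` a fundamental region), whose `Γ`-translates
cover all pairs, and on which `x = y` is the only possible pole of the Green's function. -/
def RegularPair {g : ℕ} (S : SchottkyGroup g) (x y : ℂ) : Prop :=
  x ∈ S.domain ∧ y ∈ S.domain ∧ ∀ γ ∈ S.group, γ ≠ 1 → sphereMap γ x ≠ y

/-- `G(x, y) dx^N dy^{1-N}` is a Green's function for `∂̄_N`: a bidifferential `(N, 1-N)`-form on
`Ω₀ / Γ` off the diagonal whose regular part `G^R(x, y) = G(x, y) - 1 / (x - y)`
(I) is holomorphic in `x` and (II) satisfies `(1/π) ∂G^R/∂ȳ = p_N(x, y)`. -/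
structure IsGreenFunction {g : ℕ} (S : SchottkyGroup g) (ρ : ℂ → ℝ) (N : ℕ)
    (G : ℂ → ℂ → ℂ) : Prop where
  form_left : ∀ γ ∈ S.group, ∀ x ∈ S.domain, ∀ y ∈ S.domain, S.OffOrbit x y →
    moebiusDenom γ x ≠ 0 →
      G (moebiusMap γ x) y * moebiusDenom γ x ^ (-2 * (N : ℤ)) = G x y
  form_right : ∀ γ ∈ S.group, ∀ x ∈ S.domain, ∀ y ∈ S.domain, S.OffOrbit x y →
    moebiusDenom γ y ≠ 0 →
      G x (moebiusMap γ y) * moebiusDenom γ y ^ (-2 * (1 - (N : ℤ))) = G x y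
  regular_part : ∃ (p : ℂ → ℂ → ℂ) (GR : ℂ → ℂ → ℂ), S.IsProjectionKernel ρ N p ∧
    (∀ x y, S.RegularPair x y → x ≠ y → GR x y = G x y - 1 / (x - y)) ∧
    (∀ x y, S.RegularPair x y → DifferentiableAt ℂ (fun x' => GR x' y) x) ∧
    (∀ x y, S.RegularPair x y → DifferentiableAt ℝ (fun y' => GR x y') y ∧
      1 / (Real.pi : ℂ) * wirtingerBar (fun y' => GR x y') y = p x y)

end SchottkyGroup

end

noncomputable section

open Filter Topology

/-! Fix x. In the difference G(x, ·) − G'(x, ·) the poles 1/(x − y) cancel, and the two regular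
parts have the same ∂̄ in y, because p_N does not depend on the basis that defines it
(`IsProjectionKernel.eq`). The difference is thus holomorphic near y = x; automorphy carries this to
the whole orbit Γx, so after filling in the orbit it is a holomorphic form of weight 1 − N < 0
(`exists_holomorphicForm_eq_sub`).

Such a form f vanishes. With n = N − 1, the function |f| ρ^{n/2} is Γ-invariant and attains a
maximum by compactness of Ω₀/Γ (`exists_invariantNorm_max`). Pulled back to ℍ it is |F| y^{-n} with
F holomorphic, and a maximum principle forces the maximal value to be 0
(`eq_zero_of_isLocalMax_hyperbolic_norm`). This gives f = 0 on the closed fundamental region, and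
the identity theorem on the connected set Ω₀ does the rest.

The facts needed about Γ come from ping-pong on the discs: Γ is free, the closed region lies in Ω₀,
and Γ acts freely and discontinuously there. Forms are recorded only at finite points, so every
question at ∞ is moved by a generator γ to the finite point γ∞ = a/c. -/

theorem sphereMap_one (z : OnePoint ℂ) : sphereMap 1 z = z := by
  simp [sphereMap]

theorem sphereMap_mul (γ δ : SL(2, ℂ)) (z : OnePoint ℂ) :
    sphereMap (γ * δ) z = sphereMap γ (sphereMap δ z) := by
  simp [sphereMap, mul_smul]

theorem sphereMap_inv_apply (γ : SL(2, ℂ)) (z : OnePoint ℂ) :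
    sphereMap γ⁻¹ (sphereMap γ z) = z := by
  rw [← sphereMap_mul, inv_mul_cancel, sphereMap_one]

theorem sphereMap_apply_inv (γ : SL(2, ℂ)) (z : OnePoint ℂ) :
    sphereMap γ (sphereMap γ⁻¹ z) = z := by
  rw [← sphereMap_mul, mul_inv_cancel, sphereMap_one]

theorem sphereMap_injective (γ : SL(2, ℂ)) : Function.Injective (sphereMap γ) :=
  Function.LeftInverse.injective (sphereMap_inv_apply γ)

/-! ### Möbius maps in the affine coordinate; continuity on the sphere. -/

theorem sphereMap_coe (γ : SL(2, ℂ)) (z : ℂ) :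
    sphereMap γ z = if moebiusDenom γ z = 0 then OnePoint.infty
      else (moebiusMap γ z : OnePoint ℂ) := by
  simp only [sphereMap, moebiusMap, moebiusDenom]
  rw [OnePoint.smul_some_eq_ite]
  rfl

theorem sphereMap_coe_of_ne {γ : SL(2, ℂ)} {z : ℂ} (h : moebiusDenom γ z ≠ 0) :
    sphereMap γ z = (moebiusMap γ z : OnePoint ℂ) := by
  rw [sphereMap_coe, if_neg h]

theorem sphereMap_coe_of_eq {γ : SL(2, ℂ)} {z : ℂ} (h : moebiusDenom γ z = 0) :
    sphereMap γ z = OnePoint.infty := by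
  rw [sphereMap_coe, if_pos h]

theorem moebiusDenom_ne_zero_of_sphereMap_eq {γ : SL(2, ℂ)} {z w : ℂ}
    (h : sphereMap γ z = (w : OnePoint ℂ)) : moebiusDenom γ z ≠ 0 ∧ moebiusMap γ z = w := by
  by_cases hd : moebiusDenom γ z = 0
  · rw [sphereMap_coe_of_eq hd] at h
    exact absurd h (OnePoint.infty_ne_coe w)
  · rw [sphereMap_coe_of_ne hd] at h
    exact ⟨hd, OnePoint.coe_injective h⟩

theorem sphereMap_infty (γ : SL(2, ℂ)) :
    sphereMap γ OnePoint.infty = if γ 1 0 = 0 then OnePoint.infty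
      else ((γ 0 0 / γ 1 0 : ℂ) : OnePoint ℂ) := by
  simp only [sphereMap]
  rw [OnePoint.smul_infty_eq_ite]
  rfl

theorem differentiable_moebiusDenom (γ : SL(2, ℂ)) : Differentiable ℂ (moebiusDenom γ) := by
  unfold moebiusDenom
  fun_prop

theorem differentiableAt_moebiusMap {γ : SL(2, ℂ)} {z : ℂ} (h : moebiusDenom γ z ≠ 0) :
    DifferentiableAt ℂ (moebiusMap γ) z := by
  unfold moebiusMap
  exact DifferentiableAt.div (by fun_prop) (differentiable_moebiusDenom γ z) h

theorem eventually_moebiusDenom_ne {γ : SL(2, ℂ)} {z : ℂ} (h : moebiusDenom γ z ≠ 0) :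
    ∀ᶠ w in 𝓝 z, moebiusDenom γ w ≠ 0 :=
  (differentiable_moebiusDenom γ).continuous.continuousAt.eventually_ne h

theorem sl2_det (γ : SL(2, ℂ)) : γ 0 0 * γ 1 1 - γ 0 1 * γ 1 0 = 1 := by
  have := γ.det_coe
  rwa [Matrix.det_fin_two] at this

/-- Confines the dependence on z to (cz + d)⁻¹, which makes the limits at ∞ and at the pole
immediate. -/
theorem moebiusMap_eq_sub {γ : SL(2, ℂ)} (hc : γ 1 0 ≠ 0) {z : ℂ} (hd : moebiusDenom γ z ≠ 0) :
    moebiusMap γ z = γ 0 0 / γ 1 0 - (γ 1 0)⁻¹ * (moebiusDenom γ z)⁻¹ := by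
  have hdet := sl2_det γ
  unfold moebiusMap
  field_simp
  unfold moebiusDenom
  linear_combination -hdet

theorem tendsto_coe_nhds_infty_of_cobounded {α : Type*} {l : Filter α} {f : α → ℂ}
    (hf : Tendsto f l (Bornology.cobounded ℂ)) :
    Tendsto (fun x => (f x : OnePoint ℂ)) l (𝓝 OnePoint.infty) := by
  rw [Metric.cobounded_eq_cocompact, ← coclosedCompact_eq_cocompact] at hf
  exact OnePoint.tendsto_coe_infty.comp hf

theorem tendsto_affine_cobounded {a : ℂ} (ha : a ≠ 0) (b : ℂ) :
    Tendsto (fun z : ℂ => a * z + b) (Bornology.cobounded ℂ) (Bornology.cobounded ℂ) :=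
  (tendsto_add_const_cobounded b).comp (tendsto_mul_left_cobounded ha)

theorem tendsto_moebiusDenom_cobounded {γ : SL(2, ℂ)} (hc : γ 1 0 ≠ 0) :
    Tendsto (moebiusDenom γ) (Bornology.cobounded ℂ) (Bornology.cobounded ℂ) :=
  tendsto_affine_cobounded hc _

theorem eventually_cobounded_moebiusDenom_ne {γ : SL(2, ℂ)} (hc : γ 1 0 ≠ 0) :
    ∀ᶠ z in Bornology.cobounded ℂ, moebiusDenom γ z ≠ 0 :=
  (tendsto_moebiusDenom_cobounded hc).eventually (Bornology.eventually_ne_cobounded 0)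

theorem tendsto_moebiusMap_cobounded {γ : SL(2, ℂ)} (hc : γ 1 0 ≠ 0) :
    Tendsto (moebiusMap γ) (Bornology.cobounded ℂ) (𝓝 (γ 0 0 / γ 1 0)) := by
  have h := (tendsto_inv₀_cobounded.comp (tendsto_moebiusDenom_cobounded hc)).const_mul (γ 1 0)⁻¹
  have h2 := h.const_sub (γ 0 0 / γ 1 0)
  rw [mul_zero, sub_zero] at h2
  refine h2.congr' ?_
  filter_upwards [eventually_cobounded_moebiusDenom_ne hc] with z hz
  exact (moebiusMap_eq_sub hc hz).symm

theorem continuous_sphereMap (γ : SL(2, ℂ)) : Continuous (sphereMap γ) := by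
  have hdet := sl2_det γ
  rw [continuous_iff_continuousAt, OnePoint.forall]
  constructor
  · rw [OnePoint.continuousAt_infty', coclosedCompact_eq_cocompact,
      ← Metric.cobounded_eq_cocompact, sphereMap_infty]
    split_ifs with hc
    · have ha : γ 0 0 ≠ 0 := by
        rintro h
        rw [h, hc] at hdet
        simp at hdet
      have hd : γ 1 1 ≠ 0 := by
        rintro h
        rw [h, hc] at hdet
        simp at hdet
      have h := tendsto_affine_cobounded (div_ne_zero ha hd) (γ 0 1 / γ 1 1)
      refine (tendsto_coe_nhds_infty_of_cobounded h).congr fun z => ?_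
      have hz : moebiusDenom γ z ≠ 0 := by simpa [moebiusDenom, hc] using hd
      simp only [Function.comp_apply, sphereMap_coe_of_ne hz]
      congr 1
      simp only [moebiusMap, moebiusDenom, hc, zero_mul, zero_add, add_div, mul_div_right_comm]
    · refine ((OnePoint.continuous_coe.tendsto _).comp (tendsto_moebiusMap_cobounded hc)).congr' ?_
      filter_upwards [eventually_cobounded_moebiusDenom_ne hc] with z hz
      simp only [Function.comp_apply, sphereMap_coe_of_ne hz]
  · intro z
    rw [OnePoint.continuousAt_coe]
    by_cases hz : moebiusDenom γ z = 0
    · have hc : γ 1 0 ≠ 0 := by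
        intro hc
        simp only [moebiusDenom, hc, zero_mul, zero_add] at hz
        simp [hz, hc] at hdet
      have hw : ∀ w, w ≠ z → moebiusDenom γ w ≠ 0 := by
        intro w hw h
        apply hw
        simp only [moebiusDenom] at h hz
        have : γ 1 0 * (w - z) = 0 := by linear_combination h - hz
        simpa [hc, sub_eq_zero] using this
      have h0 : Tendsto (moebiusDenom γ) (𝓝[≠] z) (𝓝[≠] 0) := by
        rw [tendsto_nhdsWithin_iff]
        refine ⟨?_, ?_⟩
        · have := (differentiable_moebiusDenom γ).continuous.tendsto z
          rw [hz] at this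
          exact this.mono_left nhdsWithin_le_nhds
        · filter_upwards [self_mem_nhdsWithin] with w h
          exact hw w h
      have h1 : Tendsto (fun w => -(γ 1 0)⁻¹ * (moebiusDenom γ w)⁻¹ + γ 0 0 / γ 1 0) (𝓝[≠] z)
          (Bornology.cobounded ℂ) :=
        (tendsto_affine_cobounded (neg_ne_zero.2 (inv_ne_zero hc)) _).comp
          (tendsto_inv₀_nhdsNE_zero.comp h0)
      have h2 : Tendsto (fun w : ℂ => sphereMap γ w) (𝓝[≠] z) (𝓝 OnePoint.infty) := by
        refine (tendsto_coe_nhds_infty_of_cobounded h1).congr' ?_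
        filter_upwards [self_mem_nhdsWithin] with w h
        rw [sphereMap_coe_of_ne (hw w h), moebiusMap_eq_sub hc (hw w h)]
        congr 1
        ring
      rw [continuousAt_iff_punctured_nhds]
      simpa only [Function.comp_def, sphereMap_coe_of_eq hz] using h2
    · have h := (OnePoint.continuous_coe (X := ℂ)).continuousAt.comp
        (differentiableAt_moebiusMap hz).continuousAt
      refine h.congr ?_
      filter_upwards [eventually_moebiusDenom_ne hz] with w hw
      simp only [Function.comp_apply, sphereMap_coe_of_ne hw]

/-! ### Topology of the closed disc bounded by a plane curve. -/

theorem isOpen_curveInside {C : Set ℂ} (hC : IsClosed C) : IsOpen (curveInside C) := by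
  rw [isOpen_iff_mem_nhds]
  rintro z ⟨hz, hb⟩
  filter_upwards [hC.isOpen_compl.connectedComponentIn.mem_nhds
    (mem_connectedComponentIn (show z ∈ Cᶜ from hz))] with w hw
  refine ⟨connectedComponentIn_subset _ _ hw, ?_⟩
  rwa [← connectedComponentIn_eq hw]

theorem isClosed_curveDisc {C : Set ℂ} (hC : IsClosed C) : IsClosed (curveDisc C) := by
  rw [← isOpen_compl_iff, isOpen_iff_mem_nhds]
  intro z hz
  have hzC : z ∈ Cᶜ := fun h => hz (Or.inl h)
  filter_upwards [hC.isOpen_compl.connectedComponentIn.mem_nhds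
    (mem_connectedComponentIn hzC)] with w hw
  rintro (h | ⟨_, h⟩)
  · exact connectedComponentIn_subset _ _ hw h
  · rw [← connectedComponentIn_eq hw] at h
    exact hz (Or.inr ⟨hzC, h⟩)

/-- If C lies in the ball of radius R and |z| > R, the ray tz, t ≥ 1, misses C, so the component of
z is unbounded. -/
theorem isBounded_curveDisc {C : Set ℂ} (hC : Bornology.IsBounded C) :
    Bornology.IsBounded (curveDisc C) := by
  obtain ⟨R, hR, hCR⟩ := hC.exists_pos_norm_le
  rw [isBounded_iff_forall_norm_le]
  refine ⟨R, ?_⟩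
  rintro z (hz | ⟨hz, hb⟩)
  · exact hCR z hz
  by_contra! hlt
  have hray : (fun t : ℝ => (t : ℂ) * z) '' Set.Ici 1 ⊆ connectedComponentIn Cᶜ z := by
    refine IsPreconnected.subset_connectedComponentIn ?_ ⟨1, by simp, by simp⟩ ?_
    · exact isPreconnected_Ici.image _ (by fun_prop)
    · rintro _ ⟨t, ht, rfl⟩ hmem
      have h1 := hCR _ hmem
      rw [norm_mul, Complex.norm_real, Real.norm_eq_abs, abs_of_nonneg (by linarith [ht.out])] at h1
      nlinarith [ht.out, norm_nonneg z]
  obtain ⟨K, hK, hKb⟩ := hb.exists_pos_norm_le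
  have h2 := hKb _ (hray ⟨K / R + 1, by simp; positivity, rfl⟩)
  rw [norm_mul, Complex.norm_real, Real.norm_eq_abs, abs_of_nonneg (by positivity)] at h2
  have h3 : (K / R + 1) * R ≤ (K / R + 1) * ‖z‖ := by gcongr
  have h4 : (K / R + 1) * R = K + R := by field_simp
  linarith

/-! ### Ping-pong: Γ is free and its closed fundamental region lies in Ω₀. -/

namespace SchottkyGroup

variable {g : ℕ} (S : SchottkyGroup g)

/-- The generators and their inverses, indexed like the letters of a free group. -/
def letter (i : Fin g × Bool) : SL(2, ℂ) :=
  cond i.2 (S.gen i.1) (S.gen i.1)⁻¹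

/-- The Jordan curve `C_i` on the sphere. -/
def sphereCurve (i : Fin g × Bool) : Set (OnePoint ℂ) :=
  (fun z : ℂ => (z : OnePoint ℂ)) '' Set.range (S.curve i)

/-- The closed disc bounded by `C_i` on the sphere. -/
def sphereDisc (i : Fin g × Bool) : Set (OnePoint ℂ) :=
  (fun z : ℂ => (z : OnePoint ℂ)) '' curveDisc (Set.range (S.curve i))

/-- The inside of `C_i` on the sphere. -/
def sphereInside (i : Fin g × Bool) : Set (OnePoint ℂ) :=
  (fun z : ℂ => (z : OnePoint ℂ)) '' curveInside (Set.range (S.curve i))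

/-- The closed fundamental region: the complement of the insides of all the curves. -/
def closedRegion : Set (OnePoint ℂ) :=
  (⋃ i, S.sphereInside i)ᶜ

theorem isCompact_curve (i : Fin g × Bool) : IsCompact (Set.range (S.curve i)) :=
  isCompact_range (S.curve_continuous i)

theorem isCompact_curveDisc (i : Fin g × Bool) :
    IsCompact (curveDisc (Set.range (S.curve i))) :=
  Metric.isCompact_of_isClosed_isBounded (isClosed_curveDisc (S.isCompact_curve i).isClosed)
    (isBounded_curveDisc (S.isCompact_curve i).isBounded)

theorem isClosed_sphereDisc (i : Fin g × Bool) : IsClosed (S.sphereDisc i) :=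
  ((S.isCompact_curveDisc i).image OnePoint.continuous_coe).isClosed

theorem isOpen_sphereInside (i : Fin g × Bool) : IsOpen (S.sphereInside i) :=
  OnePoint.isOpen_image_coe.2 (isOpen_curveInside (S.isCompact_curve i).isClosed)

theorem isClosed_closedRegion : IsClosed S.closedRegion :=
  (isOpen_iUnion S.isOpen_sphereInside).isClosed_compl

theorem mem_closedRegion {w : OnePoint ℂ} : w ∈ S.closedRegion ↔ ∀ i, w ∉ S.sphereInside i := by
  simp [closedRegion]

theorem sphereDisc_eq (i : Fin g × Bool) :
    S.sphereDisc i = S.sphereCurve i ∪ S.sphereInside i := by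
  simp only [sphereDisc, sphereCurve, sphereInside, curveDisc, Set.image_union]

theorem sphereInside_subset_sphereDisc (i : Fin g × Bool) :
    S.sphereInside i ⊆ S.sphereDisc i := by
  rw [sphereDisc_eq]
  exact Set.subset_union_right

theorem disjoint_sphereCurve_sphereInside (i : Fin g × Bool) :
    Disjoint (S.sphereCurve i) (S.sphereInside i) := by
  rw [sphereCurve, sphereInside, Set.disjoint_image_iff OnePoint.coe_injective,
    Set.disjoint_left]
  exact fun z hz h => h.1 hz

theorem disjoint_sphereDisc {i j : Fin g × Bool} (h : i ≠ j) :
    Disjoint (S.sphereDisc i) (S.sphereDisc j) :=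
  (Set.disjoint_image_iff OnePoint.coe_injective).2 (S.disc_disjoint i j h)

theorem infty_notMem_sphereDisc (i : Fin g × Bool) : OnePoint.infty ∉ S.sphereDisc i := by
  rintro ⟨z, _, hz⟩
  exact OnePoint.coe_ne_infty z hz

theorem infty_mem_closedRegion : OnePoint.infty ∈ S.closedRegion :=
  S.mem_closedRegion.2 fun i h =>
    S.infty_notMem_sphereDisc i (S.sphereInside_subset_sphereDisc i h)

theorem gen_mem_sphereCurve_iff (a : Fin g) (w : OnePoint ℂ) :
    sphereMap (S.gen a) w ∈ S.sphereCurve (a, false) ↔ w ∈ S.sphereCurve (a, true) := by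
  rw [sphereCurve, ← S.gen_curve a, (sphereMap_injective _).mem_set_image]
  rfl

theorem gen_mem_sphereInside_iff (a : Fin g) (w : OnePoint ℂ) :
    sphereMap (S.gen a) w ∈ S.sphereInside (a, false) ↔ w ∉ S.sphereDisc (a, true) := by
  rw [sphereInside, ← S.gen_exterior a, (sphereMap_injective _).mem_set_image]
  rfl

theorem gen_mem_sphereDisc_iff (a : Fin g) (w : OnePoint ℂ) :
    sphereMap (S.gen a) w ∈ S.sphereDisc (a, false) ↔ w ∉ S.sphereInside (a, true) := by
  have h : w ∈ S.sphereCurve (a, true) → w ∉ S.sphereInside (a, true) := fun h1 h2 =>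
    Set.disjoint_left.1 (S.disjoint_sphereCurve_sphereInside (a, true)) h1 h2
  rw [sphereDisc_eq, Set.mem_union, gen_mem_sphereCurve_iff, gen_mem_sphereInside_iff,
    sphereDisc_eq, Set.mem_union]
  tauto

/-- The ping-pong move; `(i.1, !i.2)` is the inverse letter. For an inverse generator it is the
closed-disc statement for the generator, negated, which is why the open and closed versions go
together. -/
theorem letter_mem_sphereInside_iff (i : Fin g × Bool) (w : OnePoint ℂ) :
    sphereMap (S.letter i) w ∈ S.sphereInside (i.1, !i.2) ↔ w ∉ S.sphereDisc i := by
  obtain ⟨a, _ | _⟩ := i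
  · have h := S.gen_mem_sphereDisc_iff a (sphereMap (S.gen a)⁻¹ w)
    rw [sphereMap_apply_inv] at h
    simp only [letter, cond_false, Bool.not_false]
    tauto
  · exact S.gen_mem_sphereInside_iff a w

theorem letter_mem_sphereDisc_iff (i : Fin g × Bool) (w : OnePoint ℂ) :
    sphereMap (S.letter i) w ∈ S.sphereDisc (i.1, !i.2) ↔ w ∉ S.sphereInside i := by
  obtain ⟨a, _ | _⟩ := i
  · have h := S.gen_mem_sphereInside_iff a (sphereMap (S.gen a)⁻¹ w)
    rw [sphereMap_apply_inv] at h
    simp only [letter, cond_false, Bool.not_false]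
    tauto
  · exact S.gen_mem_sphereDisc_iff a w

theorem letter_mem_group (i : Fin g × Bool) : S.letter i ∈ S.group := by
  have h : S.gen i.1 ∈ S.group := Subgroup.subset_closure ⟨i.1, rfl⟩
  obtain ⟨a, _ | _⟩ := i
  · exact S.group.inv_mem h
  · exact h

/-- Since w may lie on a curve, a single letter only reaches the closed disc. From the second letter
on, reducedness makes the disc already reached disjoint from the disc of the next letter, so the
image falls strictly inside. -/
theorem prod_letter_mem_sphereDisc {w : OnePoint ℂ} (hw : w ∈ S.closedRegion) :
    ∀ (L : List (Fin g × Bool)) (i : Fin g × Bool), FreeGroup.IsReduced (i :: L) →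
      sphereMap ((i :: L).map S.letter).prod w ∈ S.sphereDisc (i.1, !i.2) ∧
      (L ≠ [] → sphereMap ((i :: L).map S.letter).prod w ∈ S.sphereInside (i.1, !i.2))
  | [], i, _ => by
    simp [letter_mem_sphereDisc_iff, S.mem_closedRegion.1 hw i]
  | j :: L, i, h => by
    rw [FreeGroup.isReduced_cons_cons] at h
    have ih := (prod_letter_mem_sphereDisc hw L j h.2).1
    have hij : (j.1, !j.2) ≠ i := by
      rintro rfl
      simpa using h.1
    have hmem : sphereMap ((i :: j :: L).map S.letter).prod w ∈ S.sphereInside (i.1, !i.2) := by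
      rw [List.map_cons, List.prod_cons, sphereMap_mul, letter_mem_sphereInside_iff]
      exact Set.disjoint_left.1 (S.disjoint_sphereDisc hij) ih
    exact ⟨S.sphereInside_subset_sphereDisc _ hmem, fun _ => hmem⟩

theorem exists_lift_eq {γ : SL(2, ℂ)} (hγ : γ ∈ S.group) :
    ∃ x : FreeGroup (Fin g), FreeGroup.lift S.gen x = γ := by
  rw [group, ← FreeGroup.range_lift_eq_closure] at hγ
  exact hγ

theorem lift_gen_eq_prod (x : FreeGroup (Fin g)) :
    FreeGroup.lift S.gen x = (x.toWord.map S.letter).prod := by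
  conv_lhs => rw [← FreeGroup.mk_toWord (x := x)]
  exact FreeGroup.lift_mk

/-- A nonempty reduced word moves ∞ into one of the discs, so it is not the identity. -/
theorem lift_gen_injective : Function.Injective (FreeGroup.lift S.gen) := by
  rw [injective_iff_map_eq_one]
  intro x hx
  rw [lift_gen_eq_prod] at hx
  have hred := FreeGroup.isReduced_toWord (x := x)
  rcases hL : x.toWord with _ | ⟨i, L⟩
  · exact FreeGroup.toWord_eq_nil_iff.1 hL
  · rw [hL] at hx hred
    have h := (S.prod_letter_mem_sphereDisc S.infty_mem_closedRegion L i hred).1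
    rw [hx, sphereMap_one] at h
    exact absurd h (S.infty_notMem_sphereDisc _)

theorem pow_injective_of_mem_group {γ : SL(2, ℂ)} (hγ : γ ∈ S.group) (h1 : γ ≠ 1) :
    Function.Injective fun n : ℕ => γ ^ n := by
  obtain ⟨x, rfl⟩ := S.exists_lift_eq hγ
  have hx : x ≠ 1 := by
    rintro rfl
    exact h1 (map_one _)
  intro m n hmn
  simp only [← map_pow] at hmn
  exact IsMulTorsionFree.pow_right_injective hx (S.lift_gen_injective hmn)

/-- The group elements that move the closed fundamental region to itself or a neighbour. -/
def neighbors : Set SL(2, ℂ) :=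
  insert 1 (Set.range S.letter)

theorem finite_neighbors : S.neighbors.Finite :=
  (Set.finite_range _).insert _

theorem mem_neighbors {γ : SL(2, ℂ)} (hγ : γ ∈ S.group) {w : OnePoint ℂ}
    (hw : w ∈ S.closedRegion) (hγw : sphereMap γ w ∈ S.closedRegion) : γ ∈ S.neighbors := by
  obtain ⟨x, rfl⟩ := S.exists_lift_eq hγ
  rw [lift_gen_eq_prod] at hγw ⊢
  have hred := FreeGroup.isReduced_toWord (x := x)
  rcases hL : x.toWord with _ | ⟨i, _ | ⟨j, L⟩⟩ <;> rw [hL] at hγw hred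
  · simp [neighbors]
  · simp [neighbors]
  · exact absurd ((S.prod_letter_mem_sphereDisc hw _ i hred).2 (by simp))
      (S.mem_closedRegion.1 hγw _)

/-- The region and its neighbours cover a neighbourhood of each of its points: near a point of C_i,
whatever has slipped inside C_i is carried by the letter i to the outside of the paired curve. -/
theorem eventually_exists_mem_closedRegion {w : OnePoint ℂ} (hw : w ∈ S.closedRegion) :
    ∀ᶠ v in 𝓝 w, ∃ δ ∈ S.neighbors, δ ∈ S.group ∧ sphereMap δ v ∈ S.closedRegion := by
  by_cases hD : ∃ i, w ∈ S.sphereDisc i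
  · obtain ⟨i, hi⟩ := hD
    have hi' : sphereMap (S.letter i) w ∈ S.sphereDisc (i.1, !i.2) := by
      rw [letter_mem_sphereDisc_iff]
      exact S.mem_closedRegion.1 hw i
    have hcl : ∀ k, IsClosed (⋃ j : {j // j ≠ k}, S.sphereDisc j) := fun k =>
      isClosed_iUnion_of_finite fun j => S.isClosed_sphereDisc j.1
    have hnot : ∀ k v, v ∈ S.sphereDisc k → v ∈ (⋃ j : {j // j ≠ k}, S.sphereDisc j)ᶜ := by
      intro k v hv h
      obtain ⟨j, hj⟩ := Set.mem_iUnion.1 h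
      exact Set.disjoint_left.1 (S.disjoint_sphereDisc j.2) hj hv
    filter_upwards [(hcl i).isOpen_compl.mem_nhds (hnot _ _ hi),
      (continuous_sphereMap (S.letter i)).continuousAt.preimage_mem_nhds
        ((hcl _).isOpen_compl.mem_nhds (hnot _ _ hi'))] with v hv hv'
    simp only [Set.mem_compl_iff, Set.mem_iUnion, not_exists, Set.mem_preimage] at hv hv'
    by_cases hvi : v ∈ S.sphereInside i
    · refine ⟨S.letter i, Or.inr ⟨i, rfl⟩, S.letter_mem_group i, S.mem_closedRegion.2 fun j hj => ?_⟩
      by_cases hji : j = (i.1, !i.2)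
      · subst hji
        rw [letter_mem_sphereInside_iff] at hj
        exact hj (S.sphereInside_subset_sphereDisc _ hvi)
      · exact hv' ⟨j, hji⟩ (S.sphereInside_subset_sphereDisc _ hj)
    · refine ⟨1, Or.inl rfl, S.group.one_mem, S.mem_closedRegion.2 fun j hj => ?_⟩
      rw [sphereMap_one] at hj
      by_cases hji : j = i
      · exact hvi (hji ▸ hj)
      · exact hv ⟨j, hji⟩ (S.sphereInside_subset_sphereDisc _ hj)
  · push Not at hD
    filter_upwards [(isClosed_iUnion_of_finite S.isClosed_sphereDisc).isOpen_compl.mem_nhds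
      (by simpa using hD : w ∈ (⋃ i, S.sphereDisc i)ᶜ)] with v hv
    refine ⟨1, Or.inl rfl, S.group.one_mem, S.mem_closedRegion.2 fun j hj => ?_⟩
    rw [sphereMap_one] at hj
    exact hv (Set.mem_iUnion.2 ⟨j, S.sphereInside_subset_sphereDisc _ hj⟩)

/-- If γ_n z → w in the region, corrections δ_n from the finite set `neighbors` bring γ_n z back
into the region. Then all δ_n γ_n differ from a fixed one by neighbours, leaving finitely many γ_n.
-/
theorem closedRegion_subset_sphereDomain : S.closedRegion ⊆ S.sphereDomain := by
  rintro w hw ⟨z, γ, hinj, hγ, hlim⟩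
  obtain ⟨n₀, hn₀⟩ := eventually_atTop.1
    (hlim.eventually (S.eventually_exists_mem_closedRegion hw))
  choose! δ hδ hδΓ hδm using hn₀
  have hmem : ∀ n ≥ n₀, δ n * γ n * (δ n₀ * γ n₀)⁻¹ ∈ S.neighbors := by
    intro n hn
    refine S.mem_neighbors (S.group.mul_mem (S.group.mul_mem (hδΓ n hn) (hγ n))
      (S.group.inv_mem (S.group.mul_mem (hδΓ n₀ le_rfl) (hγ n₀)))) (hδm n₀ le_rfl) ?_
    rw [← sphereMap_mul (δ n₀), sphereMap_mul _ (δ n₀ * γ n₀)⁻¹, sphereMap_inv_apply,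
      sphereMap_mul]
    exact hδm n hn
  have hfin : (γ '' Set.Ici n₀).Finite := by
    refine ((S.finite_neighbors.prod S.finite_neighbors).image
      fun p : SL(2, ℂ) × SL(2, ℂ) => p.1⁻¹ * p.2 * (δ n₀ * γ n₀)).subset ?_
    rintro _ ⟨n, hn, rfl⟩
    exact ⟨(δ n, δ n * γ n * (δ n₀ * γ n₀)⁻¹), ⟨hδ n hn, hmem n hn⟩, by group⟩
  exact (Set.Ici_infinite n₀) (hfin.of_finite_image hinj.injOn)

end SchottkyGroup

/-! ### Free and discontinuous action of Γ on Ω₀. -/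

namespace SchottkyGroup

variable {g : ℕ} (S : SchottkyGroup g)

theorem sphereMap_mem_sphereDomain {γ : SL(2, ℂ)} (hγ : γ ∈ S.group) {w : OnePoint ℂ}
    (hw : w ∈ S.sphereDomain) : sphereMap γ w ∈ S.sphereDomain := by
  rintro ⟨z, δ, hinj, hδ, hlim⟩
  refine hw ⟨z, fun n => γ⁻¹ * δ n, fun m n h => hinj (mul_left_cancel h),
    fun n => S.group.mul_mem (S.group.inv_mem hγ) (hδ n), ?_⟩
  have h := ((continuous_sphereMap γ⁻¹).tendsto _).comp hlim
  rw [sphereMap_inv_apply] at h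
  exact h.congr fun n => (sphereMap_mul _ _ _).symm

theorem moebiusMap_mem_domain {γ : SL(2, ℂ)} (hγ : γ ∈ S.group) {z : ℂ}
    (hz : z ∈ S.domain) (hd : moebiusDenom γ z ≠ 0) : moebiusMap γ z ∈ S.domain := by
  have h := S.sphereMap_mem_sphereDomain hγ hz
  rwa [sphereMap_coe_of_ne hd] at h

/-- A fixed point of γ ≠ 1 is the limit of the constant sequence γⁿ w with distinct γⁿ, so it
belongs to the limit set. -/
theorem eq_one_of_sphereMap_eq_self {γ : SL(2, ℂ)} (hγ : γ ∈ S.group) {w : OnePoint ℂ}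
    (hw : w ∈ S.sphereDomain) (h : sphereMap γ w = w) : γ = 1 := by
  by_contra h1
  refine hw ⟨w, fun n => γ ^ n, S.pow_injective_of_mem_group hγ h1,
    fun n => S.group.pow_mem hγ n, ?_⟩
  have hpow : ∀ n : ℕ, sphereMap (γ ^ n) w = w := by
    intro n
    induction n with
    | zero => rw [pow_zero, sphereMap_one]
    | succ n ih => rw [pow_succ, sphereMap_mul, h, ih]
  simp only [hpow, tendsto_const_nhds]

theorem regularPair_self {x : ℂ} (hx : x ∈ S.domain) : S.RegularPair x x :=
  ⟨hx, hx, fun _ hγ h1 h => h1 (S.eq_one_of_sphereMap_eq_self hγ hx h)⟩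

theorem exists_nhds_finite_orbit {w : ℂ} (hw : w ∈ S.domain) (z : OnePoint ℂ) :
    ∃ U ∈ 𝓝 w, {γ ∈ S.group | ∃ u ∈ U, sphereMap γ z = (u : OnePoint ℂ)}.Finite := by
  by_contra! hcon
  have hinf : ∀ n : ℕ, {γ ∈ S.group | ∃ u ∈ Metric.ball w (1 / (n + 1)),
      sphereMap γ z = (u : OnePoint ℂ)}.Infinite := fun n =>
    hcon _ (Metric.ball_mem_nhds w (by positivity))
  obtain ⟨f, hfP, hfr⟩ := exists_seq_of_forall_finset_exists
    (fun p : ℕ × SL(2, ℂ) => p.2 ∈ S.group ∧ ∃ u ∈ Metric.ball w (1 / (p.1 + 1)),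
      sphereMap p.2 z = (u : OnePoint ℂ))
    -- The first condition makes the radii shrink to 0, the second keeps the group elements
    -- distinct.
    (fun p q => p.1 < q.1 ∧ p.2 ≠ q.2) (by
      classical
      intro s _
      obtain ⟨γ, hγ, hγs⟩ := (hinf (s.sup Prod.fst + 1)).exists_notMem_finset (s.image Prod.snd)
      refine ⟨(s.sup Prod.fst + 1, γ), hγ, fun p hp => ⟨?_, ?_⟩⟩
      · exact Nat.lt_succ_of_le (Finset.le_sup (f := Prod.fst) hp)
      · rintro h
        exact hγs (Finset.mem_image.2 ⟨p, hp, h⟩))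
  choose hfΓ u hu hfu using hfP
  have hmono : StrictMono fun n => (f n).1 := fun m n h => (hfr m n h).1
  refine hw ⟨z, fun n => (f n).2, ?_, hfΓ, ?_⟩
  · intro m n hmn
    by_contra hne
    rcases lt_or_gt_of_ne hne with h | h
    · exact (hfr m n h).2 hmn
    · exact (hfr n m h).2 hmn.symm
  · have hulim : Tendsto u atTop (𝓝 w) := by
      rw [tendsto_iff_dist_tendsto_zero]
      refine squeeze_zero (fun _ => dist_nonneg) (fun n => ?_)
        tendsto_one_div_add_atTop_nhds_zero_nat
      refine (Metric.mem_ball.1 (hu n)).le.trans ?_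
      have := hmono.le_apply (x := n)
      gcongr
    have h := (OnePoint.continuous_coe.tendsto w).comp hulim
    exact h.congr fun n => (hfu n).symm

/-- Local finiteness leaves finitely many γ to avoid. The set `A` serves three uses: all of Γ, Γ ∖
{1}, and the elements not taking x to y. -/
theorem eventually_forall_sphereMap_ne {y : ℂ} (hy : y ∈ S.domain) (x : OnePoint ℂ)
    {A : Set SL(2, ℂ)} (hA : A ⊆ S.group) (hxy : ∀ γ ∈ A, sphereMap γ x ≠ y) :
    ∀ᶠ y' : ℂ in 𝓝 y, ∀ γ ∈ A, sphereMap γ x ≠ y' := by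
  obtain ⟨U, hU, hfin⟩ := S.exists_nhds_finite_orbit hy x
  have h1 : ∀ᶠ y' : ℂ in 𝓝 y,
      ∀ γ ∈ {γ ∈ S.group | ∃ u ∈ U, sphereMap γ x = (u : OnePoint ℂ)},
        γ ∈ A → sphereMap γ x ≠ y' := by
    rw [eventually_all_finite hfin]
    intro γ _
    by_cases hγ : γ ∈ A
    · filter_upwards [OnePoint.continuous_coe.continuousAt.eventually_ne (hxy γ hγ).symm]
        with y' h _ using h.symm
    · exact Eventually.of_forall fun _ h => absurd h hγ
  filter_upwards [h1, hU] with y' h hy' γ hγ heq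
  exact h γ ⟨hA hγ, y', hy', heq⟩ hγ heq

theorem eventually_offOrbit {x y : ℂ} (hy : y ∈ S.domain) (hxy : S.OffOrbit x y) :
    ∀ᶠ y' in 𝓝 y, S.OffOrbit x y' :=
  S.eventually_forall_sphereMap_ne hy x (A := S.group) subset_rfl hxy

theorem eventually_nhdsNE_offOrbit (x : ℂ) {y : ℂ} (hy : y ∈ S.domain) :
    ∀ᶠ y' in 𝓝[≠] y, S.OffOrbit x y' := by
  have h := S.eventually_forall_sphereMap_ne hy x
    (A := {γ ∈ (S.group : Set SL(2, ℂ)) | sphereMap γ x ≠ y}) (fun γ h => h.1) (fun γ h => h.2)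
  filter_upwards [h.filter_mono nhdsWithin_le_nhds, self_mem_nhdsWithin] with y' h1 h2 γ hγ heq
  refine h1 γ ⟨hγ, fun h => h2 ?_⟩ heq
  exact OnePoint.coe_injective (heq.symm.trans h)

theorem RegularPair.eventually {S : SchottkyGroup g} (hS : IsOpen S.domain) {x y : ℂ}
    (h : S.RegularPair x y) : ∀ᶠ y' in 𝓝 y, S.RegularPair x y' := by
  have h1 := S.eventually_forall_sphereMap_ne h.2.1 x
    (A := {γ ∈ (S.group : Set SL(2, ℂ)) | γ ≠ 1}) (fun γ h => h.1) (fun γ hγ => h.2.2 γ hγ.1 hγ.2)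
  filter_upwards [h1, hS.mem_nhds h.2.1] with y' h2 h3
  exact ⟨h.1, h3, fun γ hγ h => h2 γ ⟨hγ, h⟩⟩

theorem OffOrbit.regularPair {S : SchottkyGroup g} {x y : ℂ} (hx : x ∈ S.domain)
    (hy : y ∈ S.domain) (h : S.OffOrbit x y) : S.RegularPair x y :=
  ⟨hx, hy, fun γ hγ _ => h γ hγ⟩

theorem OffOrbit.ne {S : SchottkyGroup g} {x y : ℂ} (h : S.OffOrbit x y) : x ≠ y := by
  rintro rfl
  exact h 1 S.group.one_mem (sphereMap_one _)

/-! ### Openness and connectedness of Ω₀, read off from the uniformization. -/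

namespace IsPoincareMetric

variable {S} {ρ : ℂ → ℝ}

theorem isOpen_sphereDomain (hρ : S.IsPoincareMetric ρ) : IsOpen S.sphereDomain := by
  obtain ⟨π, hcov, hrange, -⟩ := hρ.uniformization
  rw [isOpen_iff_mem_nhds]
  intro w hw
  obtain ⟨τ, rfl⟩ : w ∈ Set.range π := hrange ▸ hw
  have hloc := hcov.isLocalHomeomorphOn
  have hmap := hloc.map_nhds_eq (show τ ∈ π ⁻¹' S.sphereDomain from hw)
  rw [← hmap, mem_map]
  exact Eventually.of_forall fun t => hrange ▸ Set.mem_range_self t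

theorem isOpen_domain (hρ : S.IsPoincareMetric ρ) : IsOpen S.domain :=
  hρ.isOpen_sphereDomain.preimage OnePoint.continuous_coe

theorem isPreconnected_sphereDomain (hρ : S.IsPoincareMetric ρ) : IsPreconnected S.sphereDomain := by
  obtain ⟨π, hcov, hrange, -⟩ := hρ.uniformization
  have hcont : Continuous π := by
    rw [continuous_iff_continuousAt]
    exact fun τ => hcov.continuousAt (hrange ▸ Set.mem_range_self τ)
  rw [← hrange]
  exact isPreconnected_range hcont

end IsPoincareMetric

end SchottkyGroup

/-! ### The projection kernel does not depend on the basis. -/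

/-- Expand φ_r in the basis ψ; the coefficients are conjugates of B(ψ_s^∨, φ_r), and summing these
against φ_r^∨ reassembles ψ_s^∨. -/
theorem sum_dual_basis_mul_conj_eq {V ι κ : Type*} [AddCommGroup V] [Module ℂ V]
    [Fintype ι] [Fintype κ] [DecidableEq ι] [DecidableEq κ]
    (B : V →ₗ[ℂ] V →ₗ⋆[ℂ] ℂ) (φ φdual : Module.Basis ι ℂ V) (ψ ψdual : Module.Basis κ ℂ V)
    (hφ : ∀ r s, B (φdual r) (φ s) = if r = s then 1 else 0)
    (hψ : ∀ r s, B (ψdual r) (ψ s) = if r = s then 1 else 0) (u v : V →ₗ[ℂ] ℂ) :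
    ∑ r, u (φdual r) * (starRingEnd ℂ) (v (φ r)) =
      ∑ s, u (ψdual s) * (starRingEnd ℂ) (v (ψ s)) := by
  have h1 : ∀ χ : V, ∑ r, B χ (φ r) • φdual r = χ := by
    intro χ
    conv_rhs => rw [← φdual.sum_repr χ]
    refine Finset.sum_congr rfl fun r _ => ?_
    congr 1
    conv_lhs => rw [← φdual.sum_repr χ]
    simp [hφ, -Module.Basis.sum_repr]
  have h2 : ∀ θ : V, ∑ s, (starRingEnd ℂ) (B (ψdual s) θ) • ψ s = θ := by
    intro θ
    conv_rhs => rw [← ψ.sum_repr θ]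
    refine Finset.sum_congr rfl fun s _ => ?_
    congr 1
    conv_lhs => rw [← ψ.sum_repr θ]
    simp [hψ, -Module.Basis.sum_repr]
  calc ∑ r, u (φdual r) * (starRingEnd ℂ) (v (φ r))
      = ∑ r, u (φdual r) * ∑ s, B (ψdual s) (φ r) * (starRingEnd ℂ) (v (ψ s)) := by
        refine Finset.sum_congr rfl fun r _ => ?_
        conv_lhs => rw [← h2 (φ r)]
        simp
    _ = ∑ s, (∑ r, B (ψdual s) (φ r) * u (φdual r)) * (starRingEnd ℂ) (v (ψ s)) := by
        simp only [Finset.mul_sum, Finset.sum_mul]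
        rw [Finset.sum_comm]
        refine Finset.sum_congr rfl fun s _ => Finset.sum_congr rfl fun r _ => by ring
    _ = ∑ s, u (ψdual s) * (starRingEnd ℂ) (v (ψ s)) := by
        refine Finset.sum_congr rfl fun s _ => ?_
        conv_rhs => rw [← h1 (ψdual s)]
        simp

namespace SchottkyGroup

variable {g : ℕ} (S : SchottkyGroup g)

theorem gen_lower_left_ne_zero (a : Fin g) : S.gen a 1 0 ≠ 0 := by
  intro hc
  have h := (S.gen_mem_sphereInside_iff a OnePoint.infty).2 (S.infty_notMem_sphereDisc _)
  rw [sphereMap_infty, if_pos hc] at h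
  exact S.infty_notMem_sphereDisc _ (S.sphereInside_subset_sphereDisc _ h)

theorem gen_mem_group (a : Fin g) : S.gen a ∈ S.group :=
  Subgroup.subset_closure ⟨a, rfl⟩

/-- The image of `∞` under a generator is a finite point of `Ω₀`. -/
theorem gen_infty_mem_domain (a : Fin g) : S.gen a 0 0 / S.gen a 1 0 ∈ S.domain := by
  have h := S.sphereMap_mem_sphereDomain (S.gen_mem_group a)
    (S.closedRegion_subset_sphereDomain S.infty_mem_closedRegion)
  rwa [sphereMap_infty, if_neg (S.gen_lower_left_ne_zero a)] at h

/-- The finite part of the closed fundamental region. -/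
def finiteRegion : Set ℂ :=
  (fun z : ℂ => (z : OnePoint ℂ)) ⁻¹' S.closedRegion

theorem isClosed_finiteRegion : IsClosed S.finiteRegion :=
  S.isClosed_closedRegion.preimage OnePoint.continuous_coe

theorem finiteRegion_subset_domain : S.finiteRegion ⊆ S.domain :=
  fun _ hz => S.closedRegion_subset_sphereDomain hz

theorem fundamentalSet_subset_finiteRegion : S.fundamentalSet ⊆ S.finiteRegion := by
  intro z hz
  refine S.mem_closedRegion.2 fun i hi => ?_
  obtain ⟨w, hw, hwz⟩ := hi
  obtain rfl : w = z := OnePoint.coe_injective hwz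
  rcases hz with hz | hz
  · exact hz (Set.mem_iUnion.2 ⟨i, Or.inr hw⟩)
  · obtain ⟨a, ha⟩ := Set.mem_iUnion.1 hz
    by_cases hi : (a, true) = i
    · subst hi
      exact hw.1 ha
    · exact Set.disjoint_left.1 (S.disc_disjoint _ _ hi) (Or.inl ha) (Or.inr hw)

/-- All points near `∞` belong to the fundamental region. -/
theorem eventually_cobounded_mem_finiteRegion :
    ∀ᶠ z in Bornology.cobounded ℂ, z ∈ S.finiteRegion := by
  have h : (⋃ i, S.sphereDisc i)ᶜ ∈ 𝓝 (OnePoint.infty : OnePoint ℂ) :=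
    (isClosed_iUnion_of_finite S.isClosed_sphereDisc).isOpen_compl.mem_nhds
      (by simpa using S.infty_notMem_sphereDisc)
  filter_upwards [(tendsto_coe_nhds_infty_of_cobounded tendsto_id).eventually h] with z hz
  exact S.mem_closedRegion.2 fun i hi =>
    hz (Set.mem_iUnion.2 ⟨i, S.sphereInside_subset_sphereDisc i hi⟩)

/-- The integrand has weight (1, 1): the exponents −2N − 2N − 4(1 − N) add up to −4. -/
theorem norm_petersson_integrand_eq {ρ : ℂ → ℝ} (hρ : S.IsPoincareMetric ρ) {N : ℕ}
    {φ θ : ℂ → ℂ} (hφ : φ ∈ S.holomorphicForms N) (hθ : θ ∈ S.holomorphicForms N)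
    {γ : SL(2, ℂ)} (hγ : γ ∈ S.group) {z : ℂ} (hz : z ∈ S.domain) (hd : moebiusDenom γ z ≠ 0) :
    ‖φ z * (starRingEnd ℂ) (θ z) * ((ρ z ^ (1 - (N : ℤ)) : ℝ) : ℂ)‖ =
      ‖φ (moebiusMap γ z) * (starRingEnd ℂ) (θ (moebiusMap γ z)) *
        ((ρ (moebiusMap γ z) ^ (1 - (N : ℤ)) : ℝ) : ℂ)‖ * ‖moebiusDenom γ z‖ ^ (-4 : ℤ) := by
  have hd' : ‖moebiusDenom γ z‖ ≠ 0 := norm_ne_zero_iff.2 hd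
  have hexp : ‖moebiusDenom γ z‖ ^ (-2 * (N : ℤ)) * ‖moebiusDenom γ z‖ ^ (-2 * (N : ℤ)) *
      (‖moebiusDenom γ z‖ ^ (-4 : ℤ)) ^ (1 - (N : ℤ)) = ‖moebiusDenom γ z‖ ^ (-4 : ℤ) := by
    rw [← zpow_mul, ← zpow_add₀ hd', ← zpow_add₀ hd']
    congr 1
    ring
  rw [← hφ.2.1 γ hγ z hz hd, ← hθ.2.1 γ hγ z hz hd, ← hρ.invariant γ hγ z hz hd, mul_zpow]
  simp only [norm_mul, RCLike.norm_conj, norm_zpow, Complex.norm_real, norm_norm]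
  conv_rhs => rw [← hexp]
  ring

theorem continuousOn_petersson_integrand {ρ : ℂ → ℝ} (hρ : S.IsPoincareMetric ρ) {N : ℕ}
    {φ θ : ℂ → ℂ} (hφ : φ ∈ S.holomorphicForms N) (hθ : θ ∈ S.holomorphicForms N) :
    ContinuousOn (fun z => φ z * (starRingEnd ℂ) (θ z) * ((ρ z ^ (1 - (N : ℤ)) : ℝ) : ℂ))
      S.domain := by
  have h1 : ContinuousOn φ S.domain := fun z hz => (hφ.1 z hz).continuousAt.continuousWithinAt
  have h2 : ContinuousOn θ S.domain := fun z hz => (hθ.1 z hz).continuousAt.continuousWithinAt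
  have h3 : ContinuousOn (fun z => ρ z ^ (1 - (N : ℤ))) S.domain :=
    hρ.smooth.continuousOn.zpow₀ _ fun z hz => Or.inl (hρ.pos z hz).ne'
  exact (h1.mul (Complex.continuous_conj.comp_continuousOn h2)).mul
    (Complex.continuous_ofReal.comp_continuousOn h3)

/-- Needed for additivity of the Petersson integral. The fundamental set is unbounded, but near ∞
the integrand equals its value near γ∞, which is bounded, times |cz + d|⁻⁴, which is integrable at
infinity. -/
theorem integrableOn_petersson_integrand (hg : 0 < g) {ρ : ℂ → ℝ} (hρ : S.IsPoincareMetric ρ)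
    {N : ℕ} {φ θ : ℂ → ℂ} (hφ : φ ∈ S.holomorphicForms N) (hθ : θ ∈ S.holomorphicForms N) :
    MeasureTheory.IntegrableOn
      (fun z => φ z * (starRingEnd ℂ) (θ z) * ((ρ z ^ (1 - (N : ℤ)) : ℝ) : ℂ))
      S.fundamentalSet := by
  refine MeasureTheory.IntegrableOn.mono_set ?_ S.fundamentalSet_subset_finiteRegion
  have hcont := S.continuousOn_petersson_integrand hρ hφ hθ
  have hnorm : ∀ z ∈ S.domain, moebiusDenom (S.gen ⟨0, hg⟩) z ≠ 0 → _ := fun z =>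
    S.norm_petersson_integrand_eq hρ hφ hθ (S.gen_mem_group ⟨0, hg⟩)
  set q := fun z => φ z * (starRingEnd ℂ) (θ z) * ((ρ z ^ (1 - (N : ℤ)) : ℝ) : ℂ) with hq
  set γ := S.gen ⟨0, hg⟩ with hγ
  have hc : γ 1 0 ≠ 0 := S.gen_lower_left_ne_zero _
  have hc' : 0 < ‖γ 1 0‖ := norm_pos_iff.2 hc
  have hw : γ 0 0 / γ 1 0 ∈ S.domain := S.gen_infty_mem_domain _
  have hqw : ContinuousAt q (γ 0 0 / γ 1 0) := hcont.continuousAt (hρ.isOpen_domain.mem_nhds hw)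
  have hbd : ∀ᶠ z in Bornology.cobounded ℂ, z ∈ S.finiteRegion →
      ‖q z‖ ≤ (‖q (γ 0 0 / γ 1 0)‖ + 1) * (‖γ 1 0‖ / 4) ^ (-4 : ℤ) * (1 + ‖z‖) ^ (-4 : ℝ) := by
    filter_upwards [eventually_cobounded_moebiusDenom_ne hc,
      (tendsto_moebiusMap_cobounded hc).eventually
        (hqw.norm.eventually_le_const (lt_add_one ‖q (γ 0 0 / γ 1 0)‖)),
      eventually_cobounded_le_norm (1 : ℝ),
      eventually_cobounded_le_norm (2 * ‖γ 1 1‖ / ‖γ 1 0‖)] with z hd hK h1 h2 hz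
    have h3 := hnorm z (S.finiteRegion_subset_domain hz) hd
    -- From |z| ≥ 2|d|/|c| follows |cz + d| ≥ |c||z|/2, and |z| ≥ 1 turns this into |c|(1 + |z|)/4.
    have h4 : ‖γ 1 0‖ / 4 * (1 + ‖z‖) ≤ ‖moebiusDenom γ z‖ := by
      have h5 : ‖γ 1 0‖ * ‖z‖ - ‖γ 1 1‖ ≤ ‖moebiusDenom γ z‖ := by
        have := norm_sub_le (moebiusDenom γ z) (γ 1 1)
        have h6 : moebiusDenom γ z - γ 1 1 = γ 1 0 * z := by simp [moebiusDenom]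
        rw [h6, norm_mul] at this
        linarith
      rw [div_le_iff₀ hc'] at h2
      nlinarith
    have h5 : ‖moebiusDenom γ z‖ ^ (-4 : ℤ) ≤ (‖γ 1 0‖ / 4 * (1 + ‖z‖)) ^ (-4 : ℤ) := by
      rw [zpow_neg, zpow_neg]
      gcongr ?_⁻¹
      exact zpow_le_zpow_left₀ (by norm_num) (by positivity) h4
    have h6 : (1 + ‖z‖) ^ (-4 : ℝ) = (1 + ‖z‖) ^ (-4 : ℤ) := by
      rw [← Real.rpow_intCast]
      norm_num
    rw [h6, mul_assoc, ← mul_zpow]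
    exact h3.trans_le (mul_le_mul hK h5 (by positivity) (by positivity))
  obtain ⟨R, -, hR⟩ := hasBasis_cobounded_norm.eventually_iff.1 hbd
  rw [← Set.inter_union_compl S.finiteRegion (Metric.closedBall 0 R)]
  refine MeasureTheory.IntegrableOn.union ?_ ?_
  · exact (hcont.mono (Set.inter_subset_left.trans S.finiteRegion_subset_domain)).integrableOn_compact
      ((isCompact_closedBall 0 R).inter_left S.isClosed_finiteRegion)
  · have hmeas : MeasurableSet (S.finiteRegion ∩ (Metric.closedBall 0 R)ᶜ) :=
      S.isClosed_finiteRegion.measurableSet.inter Metric.isClosed_closedBall.measurableSet.compl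
    have hint : MeasureTheory.Integrable fun z : ℂ => (1 + ‖z‖) ^ (-4 : ℝ) :=
      integrable_one_add_norm (by rw [Complex.finrank_real_complex]; norm_num)
    refine (hint.const_mul
      ((‖q (γ 0 0 / γ 1 0)‖ + 1) * (‖γ 1 0‖ / 4) ^ (-4 : ℤ))).integrableOn.mono' ?_ ?_
    · exact (hcont.mono
        (Set.inter_subset_left.trans S.finiteRegion_subset_domain)).aestronglyMeasurable hmeas
    · rw [MeasureTheory.ae_restrict_iff' hmeas]
      refine Eventually.of_forall fun z hz => hR ?_ hz.1
      have := hz.2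
      simp only [Set.mem_compl_iff, Metric.mem_closedBall, dist_zero_right, not_le] at this
      exact this.le

/-- The Petersson product as a sesquilinear form. -/
def peterssonForm (hg : 0 < g) {ρ : ℂ → ℝ} (hρ : S.IsPoincareMetric ρ) (N : ℕ) :
    S.holomorphicForms N →ₗ[ℂ] S.holomorphicForms N →ₗ⋆[ℂ] ℂ :=
  LinearMap.mk₂'ₛₗ (RingHom.id ℂ) (starRingEnd ℂ)
    (fun φ θ => S.petersson ρ N φ θ)
    (fun φ₁ φ₂ θ => by
      simp only [petersson, Submodule.coe_add, Pi.add_apply, add_mul]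
      exact MeasureTheory.integral_add (S.integrableOn_petersson_integrand hg hρ φ₁.2 θ.2)
        (S.integrableOn_petersson_integrand hg hρ φ₂.2 θ.2))
    (fun c φ θ => by
      simp only [petersson, Submodule.coe_smul, Pi.smul_apply, smul_eq_mul, mul_assoc,
        RingHom.id_apply]
      exact MeasureTheory.integral_const_mul c _)
    (fun φ θ₁ θ₂ => by
      simp only [petersson, Submodule.coe_add, Pi.add_apply, map_add, mul_add, add_mul]
      exact MeasureTheory.integral_add (S.integrableOn_petersson_integrand hg hρ φ.2 θ₁.2)
        (S.integrableOn_petersson_integrand hg hρ φ.2 θ₂.2))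
    (fun c φ θ => by
      simp only [petersson, Submodule.coe_smul, Pi.smul_apply, smul_eq_mul, map_mul]
      rw [← MeasureTheory.integral_const_mul]
      congr 1
      ext z
      ring)

theorem IsProjectionKernel.eq {S : SchottkyGroup g} (hg : 0 < g) {ρ : ℂ → ℝ}
    (hρ : S.IsPoincareMetric ρ) {N : ℕ} {p p' : ℂ → ℂ → ℂ} (hp : S.IsProjectionKernel ρ N p)
    (hp' : S.IsProjectionKernel ρ N p') {x y : ℂ} (hx : x ∈ S.domain) (hy : y ∈ S.domain) :
    p x y = p' x y := by
  obtain ⟨d, φ, φdual, hφ, hpφ⟩ := hp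
  obtain ⟨d', ψ, ψdual, hψ, hpψ⟩ := hp'
  rw [hpφ x hx y hy, hpψ x hx y hy, ← Finset.sum_mul, ← Finset.sum_mul]
  congr 1
  exact sum_dual_basis_mul_conj_eq (S.peterssonForm hg hρ N) φ φdual ψ ψdual hφ hψ
    ((LinearMap.proj x).comp (S.holomorphicForms N).subtype)
    ((LinearMap.proj y).comp (S.holomorphicForms N).subtype)

end SchottkyGroup

/-! ### Holomorphic forms of negative weight vanish. -/

/-- The n-th power of s < e^{s−1}, valid for s = y/y₀ ≠ 1: yⁿ e^{−ny/y₀} has its strict maximum at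
y₀. -/
theorem pow_mul_exp_lt {n : ℕ} (hn : n ≠ 0) {y y₀ : ℝ} (hy : 0 < y) (hy₀ : 0 < y₀) (hne : y ≠ y₀) :
    y ^ n * Real.exp (-(n * (y / y₀))) < y₀ ^ n * Real.exp (-(n * 1)) := by
  have h : y / y₀ < Real.exp (y / y₀ - 1) := by
    have := Real.add_one_lt_exp (x := y / y₀ - 1) (by
      rw [Ne, sub_eq_zero, div_eq_one_iff_eq hy₀.ne']
      exact hne)
    linarith
  have h2 : (y / y₀) ^ n < Real.exp (y / y₀ - 1) ^ n := by
    gcongr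
  rw [← Real.exp_nat_mul, div_pow, div_lt_iff₀ (by positivity)] at h2
  calc y ^ n * Real.exp (-(n * (y / y₀)))
      < Real.exp (n * (y / y₀ - 1)) * y₀ ^ n * Real.exp (-(n * (y / y₀))) := by gcongr
    _ = y₀ ^ n * (Real.exp (n * (y / y₀ - 1)) * Real.exp (-(n * (y / y₀)))) := by ring
    _ = y₀ ^ n * Real.exp (-(n * 1)) := by
        rw [← Real.exp_add]
        ring_nf

/-- A holomorphic function `F` of weight `-2n < 0` near a point of the upper half plane
vanishes at every local maximum of its hyperbolic norm `|F| y⁻ⁿ`. -/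
theorem eq_zero_of_isLocalMax_hyperbolic_norm {n : ℕ} (hn : n ≠ 0) {F : ℂ → ℂ} {τ : ℂ}
    (hτ : 0 < τ.im) {M : ℝ} (hF : ∀ᶠ t in 𝓝 τ, DifferentiableAt ℂ F t)
    (hle : ∀ᶠ t in 𝓝 τ, ‖F t‖ ≤ M * t.im ^ n) (heq : ‖F τ‖ = M * τ.im ^ n) : M = 0 := by
  have hM : 0 ≤ M := by
    have : 0 ≤ M * τ.im ^ n := heq ▸ norm_nonneg _
    exact nonneg_of_mul_nonneg_left this (by positivity)
  -- The exponential has modulus e^{−n Im t / Im τ}, tuned so that the bound M yⁿ e^{−ny/y₀} peaks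
  -- at y₀ = Im τ. Hence |E| has a local maximum at τ and E is locally constant.
  set E : ℂ → ℂ := fun t => F t * Complex.exp (Complex.I * n * (t / τ.im)) with hE
  have hnorm : ∀ t, ‖E t‖ = ‖F t‖ * Real.exp (-(n * (t.im / τ.im))) := by
    intro t
    rw [hE, norm_mul, Complex.norm_exp]
    congr 2
    have h : Complex.I * n * (t / τ.im) = ((n / τ.im : ℝ) : ℂ) * (Complex.I * t) := by
      push_cast
      ring
    rw [h, Complex.re_ofReal_mul, Complex.I_mul_re]
    ring
  have hEτ : ‖E τ‖ = M * (τ.im ^ n * Real.exp (-(n * 1))) := by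
    rw [hnorm, heq, div_self hτ.ne', mul_assoc]
  have him : ∀ᶠ t : ℂ in 𝓝 τ, 0 < t.im := Complex.continuous_im.continuousAt.eventually_const_lt hτ
  have hbound : ∀ᶠ t in 𝓝 τ, ‖E t‖ ≤ M * (t.im ^ n * Real.exp (-(n * (t.im / τ.im)))) := by
    filter_upwards [hle] with t ht
    rw [hnorm, ← mul_assoc]
    gcongr
  have hmax : IsLocalMax (norm ∘ E) τ := by
    filter_upwards [hbound, him] with t ht hti
    simp only [Function.comp_apply, hEτ]
    refine ht.trans (mul_le_mul_of_nonneg_left ?_ hM)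
    by_cases h : t.im = τ.im
    · rw [h, div_self hτ.ne']
    · exact (pow_mul_exp_lt hn hti hτ h).le
  have hEd : ∀ᶠ t in 𝓝 τ, DifferentiableAt ℂ E t := by
    filter_upwards [hF] with t ht
    exact ht.mul (by fun_prop)
  have hconst := Complex.eventually_eq_of_isLocalMax_norm hEd hmax
  have hlim : Tendsto (fun s : ℝ => τ + s * Complex.I) (𝓝[>] 0) (𝓝 τ) := by
    have : Continuous fun s : ℝ => τ + s * Complex.I := by fun_prop
    simpa using (this.tendsto 0).mono_left nhdsWithin_le_nhds
  -- Moving straight up from τ keeps E constant while the bound strictly drops, unless M = 0.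
  obtain ⟨s, ⟨h1, h2⟩, hs⟩ :=
    ((hlim.eventually (hconst.and hbound)).and self_mem_nhdsWithin).exists
  have him' : (τ + s * Complex.I).im = τ.im + s := by simp
  rw [h1, hEτ, him'] at h2
  by_contra hM0
  have hlt := pow_mul_exp_lt hn (add_pos hτ hs) hτ (y := τ.im + s)
    (by simpa using (show (0 : ℝ) < s from hs).ne')
  have := mul_lt_mul_of_pos_left hlt (lt_of_le_of_ne hM (Ne.symm hM0))
  linarith

namespace SchottkyGroup

variable {g : ℕ} (S : SchottkyGroup g)

/-- The invariant norm `|f| ρ^{n/2}` of a form of weight `-n`. -/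
def invariantNorm (ρ : ℂ → ℝ) (n : ℕ) (f : ℂ → ℂ) (z : ℂ) : ℝ :=
  ‖f z‖ * √(ρ z) ^ n

variable {S} {ρ : ℂ → ℝ} {n : ℕ} {f : ℂ → ℂ}

theorem invariantNorm_moebiusMap (hρ : S.IsPoincareMetric ρ)
    (hf : f ∈ S.holomorphicForms (-(n : ℤ))) {γ : SL(2, ℂ)} (hγ : γ ∈ S.group) {z : ℂ}
    (hz : z ∈ S.domain) (hd : moebiusDenom γ z ≠ 0) :
    invariantNorm ρ n f (moebiusMap γ z) = invariantNorm ρ n f z := by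
  have hd' : ‖moebiusDenom γ z‖ ≠ 0 := norm_ne_zero_iff.2 hd
  have h1 : ‖moebiusDenom γ z‖ ^ (-4 : ℤ) = ((‖moebiusDenom γ z‖ ^ 2)⁻¹) ^ 2 := by
    rw [zpow_neg, inv_pow, ← pow_mul]
    rfl
  have h2 : moebiusDenom γ z ^ (-2 * -(n : ℤ)) = moebiusDenom γ z ^ (2 * n) := by
    rw [neg_mul_neg]
    exact_mod_cast zpow_natCast (moebiusDenom γ z) (2 * n)
  rw [invariantNorm, invariantNorm, ← hf.2.1 γ hγ z hz hd, ← hρ.invariant γ hγ z hz hd, h1, h2,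
    Real.sqrt_mul (hρ.pos _ (S.moebiusMap_mem_domain hγ hz hd)).le, Real.sqrt_sq (by positivity),
    norm_mul, norm_pow, mul_pow, inv_pow, ← pow_mul]
  field_simp

theorem continuousOn_invariantNorm (hρ : S.IsPoincareMetric ρ)
    (hf : f ∈ S.holomorphicForms (-(n : ℤ))) : ContinuousOn (invariantNorm ρ n f) S.domain := by
  have h1 : ContinuousOn f S.domain := fun z hz => (hf.1 z hz).continuousAt.continuousWithinAt
  exact h1.norm.mul (hρ.smooth.continuousOn.sqrt.pow n)

/-- In the covering coordinate √ρ |P'| = 1/y, so F = f(P)/P'ⁿ satisfies |F| = (|f| ρ^{n/2})(P) · yⁿ.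
-/
theorem invariantNorm_eq_zero_of_isLocalMax (hρ : S.IsPoincareMetric ρ) (hn : n ≠ 0)
    (hf : f ∈ S.holomorphicForms (-(n : ℤ))) {w : ℂ} (hw : w ∈ S.domain)
    (hmax : ∀ᶠ z in 𝓝 w, invariantNorm ρ n f z ≤ invariantNorm ρ n f w) :
    invariantNorm ρ n f w = 0 := by
  obtain ⟨π, hcov, hrange, hπ⟩ := hρ.uniformization
  obtain ⟨τ, hτ⟩ : (w : OnePoint ℂ) ∈ Set.range π := hrange ▸ hw
  set P : ℂ → ℂ := fun t => (π (UpperHalfPlane.ofComplex t)).elim (0 : ℂ) id with hP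
  have hPτ : P τ = w := by simp [hP, hτ]
  have him : ∀ᶠ t : ℂ in 𝓝 (τ : ℂ), 0 < t.im :=
    Complex.continuous_im.continuousAt.eventually_const_lt τ.im_pos
  have hcoe : ∀ t : ℂ, 0 < t.im → ((UpperHalfPlane.ofComplex t : ℍ) : ℂ) = t := fun t ht => by
    rw [UpperHalfPlane.ofComplex_apply_of_im_pos ht]
  have hfin : ∀ᶠ t : ℂ in 𝓝 (τ : ℂ), π (UpperHalfPlane.ofComplex t) = (P t : OnePoint ℂ) := by
    have hc : ContinuousAt (fun t : ℂ => π (UpperHalfPlane.ofComplex t)) τ := by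
      refine ContinuousAt.comp (g := π) ?_ ?_
      · exact hcov.continuousAt (hrange ▸ Set.mem_range_self _)
      · exact UpperHalfPlane.contMDiffAt_ofComplex (n := 0) τ.im_pos |>.continuousAt
    have := hc.eventually (OnePoint.isOpen_range_coe.mem_nhds
      (by simp [hτ]))
    filter_upwards [this] with t ⟨z, hz⟩
    simp [hP, ← hz]
  have hder : ∀ᶠ t : ℂ in 𝓝 (τ : ℂ), DifferentiableAt ℂ P t ∧
      ρ (P t) * ‖deriv P t‖ ^ 2 = t.im ^ (-2 : ℤ) := by
    filter_upwards [him, hfin] with t ht htP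
    obtain ⟨c, hc, hρc⟩ := hπ _ _ htP
    rw [hcoe t ht] at hc
    rw [← UpperHalfPlane.coe_im, hcoe t ht] at hρc
    exact ⟨hc.differentiableAt, hc.deriv ▸ hρc⟩
  have hdom : ∀ᶠ t : ℂ in 𝓝 (τ : ℂ), P t ∈ S.domain := by
    filter_upwards [hfin] with t ht
    show (P t : OnePoint ℂ) ∈ S.sphereDomain
    rw [← ht, ← hrange]
    exact Set.mem_range_self _
  have hder2 : ∀ᶠ t : ℂ in 𝓝 (τ : ℂ), DifferentiableAt ℂ (deriv P) t := by
    filter_upwards [hder.eventually_nhds] with t ht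
    exact (Complex.analyticAt_iff_eventually_differentiableAt.2
      (ht.mono fun _ h => h.1)).deriv.differentiableAt
  have hsqrt : ∀ᶠ t : ℂ in 𝓝 (τ : ℂ), deriv P t ≠ 0 ∧
      ‖f (P t) / deriv P t ^ n‖ = invariantNorm ρ n f (P t) * t.im ^ n := by
    filter_upwards [hder, him, hdom] with t ⟨_, h⟩ ht hd
    have h0 : deriv P t ≠ 0 := by
      intro h0
      rw [h0] at h
      simp only [norm_zero, ne_eq, OfNat.ofNat_ne_zero, not_false_eq_true, zero_pow,
        mul_zero] at h
      exact (zpow_pos ht _).ne h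
    have h1 : √(ρ (P t)) * ‖deriv P t‖ = t.im⁻¹ := by
      have h2 : (√(ρ (P t)) * ‖deriv P t‖) ^ 2 = (t.im⁻¹) ^ 2 := by
        rw [mul_pow, Real.sq_sqrt (hρ.pos _ hd).le, h, zpow_neg, inv_pow]
        rfl
      exact (pow_left_inj₀ (by positivity) (by positivity) two_ne_zero).1 h2
    refine ⟨h0, ?_⟩
    have h3 : √(ρ (P t)) * t.im = ‖deriv P t‖⁻¹ := by
      have := norm_ne_zero_iff.2 h0
      field_simp at h1 ⊢
      linarith
    rw [invariantNorm, mul_assoc, ← mul_pow, h3, norm_div, norm_pow, inv_pow, div_eq_mul_inv]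
  refine eq_zero_of_isLocalMax_hyperbolic_norm hn (F := fun t => f (P t) / deriv P t ^ n) τ.im_pos
    ?_ ?_ ?_
  · filter_upwards [hder, hder2, hsqrt, hdom] with t h1 h2 h3 h4
    exact ((hf.1 _ h4).comp t h1.1).div (h2.pow n) (pow_ne_zero _ h3.1)
  · have hlim : Tendsto P (𝓝 (τ : ℂ)) (𝓝 w) := by
      have := hder.self_of_nhds.1.continuousAt.tendsto
      rwa [hPτ] at this
    filter_upwards [hsqrt, hlim.eventually hmax, him] with t h1 h2 h3
    rw [h1.2]
    gcongr
  · rw [hsqrt.self_of_nhds.2, hPτ]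

end SchottkyGroup

namespace SchottkyGroup

variable {g : ℕ} {S : SchottkyGroup g} {ρ : ℂ → ℝ} {n : ℕ} {f : ℂ → ℂ}

theorem moebiusMap_gen_ne (a : Fin g) {z : ℂ} (hd : moebiusDenom (S.gen a) z ≠ 0) :
    moebiusMap (S.gen a) z ≠ S.gen a 0 0 / S.gen a 1 0 := by
  intro h
  have h1 : sphereMap (S.gen a) z = sphereMap (S.gen a) OnePoint.infty := by
    rw [sphereMap_coe_of_ne hd, sphereMap_infty, if_neg (S.gen_lower_left_ne_zero a), h]
  exact OnePoint.coe_ne_infty z (sphereMap_injective _ h1)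

theorem exists_invariantNorm_max (hg : 0 < g) (hρ : S.IsPoincareMetric ρ)
    (hf : f ∈ S.holomorphicForms (-(n : ℤ))) :
    ∃ w ∈ S.domain, (∀ z ∈ S.finiteRegion, invariantNorm ρ n f z ≤ invariantNorm ρ n f w) ∧
      ∀ᶠ z in 𝓝 w, invariantNorm ρ n f z ≤ invariantNorm ρ n f w := by
  set B := invariantNorm ρ n f with hB
  have hinv : ∀ γ ∈ S.group, ∀ z ∈ S.domain, moebiusDenom γ z ≠ 0 → B (moebiusMap γ z) = B z :=
    fun γ hγ z hz hd => invariantNorm_moebiusMap hρ hf hγ hz hd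
  set γ := S.gen ⟨0, hg⟩ with hγ
  have hγΓ : γ ∈ S.group := S.gen_mem_group _
  have hc : γ 1 0 ≠ 0 := S.gen_lower_left_ne_zero _
  set p : ℂ := γ 0 0 / γ 1 0 with hp
  have hpγ : sphereMap γ OnePoint.infty = (p : OnePoint ℂ) := by
    rw [sphereMap_infty, if_neg hc]
  have hpdom : p ∈ S.domain := S.gen_infty_mem_domain _
  have hW : ∀ᶠ v : ℂ in 𝓝 p, v ∈ S.domain ∧ sphereMap γ⁻¹ v ∈ (⋃ i, S.sphereDisc i)ᶜ := by
    refine (hρ.isOpen_domain.eventually_mem hpdom).and ?_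
    refine ((continuous_sphereMap γ⁻¹).comp OnePoint.continuous_coe).continuousAt.eventually_mem
      ((isClosed_iUnion_of_finite S.isClosed_sphereDisc).isOpen_compl.mem_nhds ?_)
    rw [Function.comp_apply, ← hpγ, sphereMap_inv_apply]
    simpa using S.infty_notMem_sphereDisc
  obtain ⟨ε, hε, hεW⟩ := Metric.nhds_basis_closedBall.eventually_iff.1 hW.eventually_nhds
  obtain ⟨R, -, hR⟩ := hasBasis_cobounded_norm.eventually_iff.1
    ((eventually_cobounded_moebiusDenom_ne hc).and
      ((tendsto_moebiusMap_cobounded hc).eventually (Metric.closedBall_mem_nhds p hε)))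
  set K : Set ℂ := S.finiteRegion ∩ Metric.closedBall 0 R ∪ Metric.closedBall p ε with hK
  have hKcompact : IsCompact K :=
    ((isCompact_closedBall 0 R).inter_left S.isClosed_finiteRegion).union (isCompact_closedBall p ε)
  have hKdom : K ⊆ S.domain := by
    rintro z (hz | hz)
    · exact S.finiteRegion_subset_domain hz.1
    · exact (hεW hz).self_of_nhds.1
  have hpK : p ∈ K := Or.inr (Metric.mem_closedBall_self hε.le)
  obtain ⟨w, hwK, hw⟩ := hKcompact.exists_isMaxOn ⟨p, hpK⟩
    ((continuousOn_invariantNorm hρ hf).mono hKdom)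
  have hw' : ∀ z ∈ K, B z ≤ B w := fun z hz => hw hz
  have hregion : ∀ z ∈ S.finiteRegion, B z ≤ B w := by
    intro z hz
    rcases le_or_gt ‖z‖ R with h | h
    · exact hw' z (Or.inl ⟨hz, by simpa using h⟩)
    · obtain ⟨h1, h2⟩ := hR h.le
      rw [← hinv γ hγΓ z (S.finiteRegion_subset_domain hz) h1]
      exact hw' _ (Or.inr h2)
  have htranslate : ∀ z ∈ S.domain, ∀ δ ∈ S.group, sphereMap δ z ∈ S.closedRegion →
      B z ≤ B w := by
    intro z hz δ hδ hδz
    by_cases hd : moebiusDenom δ z = 0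
    · have h1 : sphereMap (γ * δ) z = (p : OnePoint ℂ) := by
        rw [sphereMap_mul, sphereMap_coe_of_eq hd, hpγ]
      obtain ⟨h2, h3⟩ := moebiusDenom_ne_zero_of_sphereMap_eq h1
      rw [← hinv _ (S.group.mul_mem hγΓ hδ) z hz h2, h3]
      exact hw' p hpK
    · rw [← hinv δ hδ z hz hd]
      rw [sphereMap_coe_of_ne hd] at hδz
      exact hregion _ hδz
  refine ⟨w, hKdom hwK, hregion, ?_⟩
  -- The maximum is also local in Ω₀: near the region neighbours bring points back to it, and γ⁻¹
  -- carries the ball around p into the region.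
  rcases hwK with h | h
  · have h1 := OnePoint.continuous_coe.continuousAt.eventually
      (S.eventually_exists_mem_closedRegion h.1)
    filter_upwards [h1, hρ.isOpen_domain.mem_nhds (S.finiteRegion_subset_domain h.1)]
      with z ⟨δ, _, hδ, hδz⟩ hz using htranslate z hz δ hδ hδz
  · filter_upwards [hεW h] with z hz
    refine htranslate z hz.1 γ⁻¹ (S.group.inv_mem hγΓ) (S.mem_closedRegion.2 fun i hi => ?_)
    exact hz.2 (Set.mem_iUnion.2 ⟨i, S.sphereInside_subset_sphereDisc i hi⟩)

theorem eq_zero_on_finiteRegion (hg : 0 < g) (hρ : S.IsPoincareMetric ρ) (hn : n ≠ 0)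
    (hf : f ∈ S.holomorphicForms (-(n : ℤ))) {z : ℂ} (hz : z ∈ S.finiteRegion) : f z = 0 := by
  obtain ⟨w, hw, hmax, hloc⟩ := exists_invariantNorm_max hg hρ hf
  have h := hmax z hz
  rw [invariantNorm_eq_zero_of_isLocalMax hρ hn hf hw hloc, invariantNorm] at h
  have hpos := Real.sqrt_pos.2 (hρ.pos z (S.finiteRegion_subset_domain hz))
  have h2 : ‖f z‖ ≤ 0 := nonpos_of_mul_nonpos_left h (by positivity)
  simpa using h2

theorem analyticAt_of_mem_holomorphicForms (hρ : S.IsPoincareMetric ρ) {k : ℤ}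
    (hf : f ∈ S.holomorphicForms k) {z : ℂ} (hz : z ∈ S.domain) : AnalyticAt ℂ f z :=
  Complex.analyticAt_iff_eventually_differentiableAt.2
    ((hρ.isOpen_domain.eventually_mem hz).mono hf.1)

/-- Near a point of `Ω₀`, an automorphic form either vanishes or has no further zeros. -/
theorem eventually_eq_zero_or_ne_zero (hg : 0 < g) (hρ : S.IsPoincareMetric ρ) {k : ℤ}
    (hf : f ∈ S.holomorphicForms k) {w : OnePoint ℂ} (hw : w ∈ S.sphereDomain) :
    (∀ᶠ v in 𝓝 w, v.elim 0 f = 0) ∨ ∀ᶠ v in 𝓝[≠] w, v.elim 0 f ≠ 0 := by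
  induction w with
  | infty =>
    rw [OnePoint.nhds_infty_eq, OnePoint.nhdsNE_infty_eq, eventually_sup, eventually_map,
      eventually_map, eventually_pure, coclosedCompact_eq_cocompact, ← Metric.cobounded_eq_cocompact]
    -- The value 0 assigned at ∞ makes the condition at the point itself trivial; zeros near ∞ are
    -- zeros near γ∞.
    simp only [OnePoint.elim_some, OnePoint.elim_infty, and_true]
    have hc := S.gen_lower_left_ne_zero ⟨0, hg⟩
    have hden := eventually_cobounded_moebiusDenom_ne hc
    have hinv : ∀ᶠ z in Bornology.cobounded ℂ,
        f (moebiusMap (S.gen ⟨0, hg⟩) z) = 0 ↔ f z = 0 := by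
      filter_upwards [hden, S.eventually_cobounded_mem_finiteRegion] with z hd hz
      rw [← hf.2.1 _ (S.gen_mem_group _) z (S.finiteRegion_subset_domain hz) hd,
        mul_eq_zero_iff_right (zpow_ne_zero _ hd)]
    have hlim : Tendsto (moebiusMap (S.gen ⟨0, hg⟩)) (Bornology.cobounded ℂ)
        (𝓝[≠] (S.gen ⟨0, hg⟩ 0 0 / S.gen ⟨0, hg⟩ 1 0)) :=
      tendsto_nhdsWithin_iff.2 ⟨tendsto_moebiusMap_cobounded hc,
        hden.mono fun z hd => moebiusMap_gen_ne _ hd⟩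
    rcases (analyticAt_of_mem_holomorphicForms hρ hf
      (S.gen_infty_mem_domain ⟨0, hg⟩)).eventually_eq_zero_or_eventually_ne_zero with h | h
    · left
      filter_upwards [(hlim.mono_right nhdsWithin_le_nhds).eventually h, hinv] with z h1 h2
        using h2.1 h1
    · right
      filter_upwards [hlim.eventually h, hinv] with z h1 h2 h3 using h1 (h2.2 h3)
  | coe z =>
    rw [OnePoint.nhdsWithin_coe, OnePoint.nhds_coe_eq, eventually_map, eventually_map]
    have hpre : (fun z : ℂ => (z : OnePoint ℂ)) ⁻¹' {(z : OnePoint ℂ)}ᶜ = {z}ᶜ := by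
      ext v
      simp
    rw [hpre]
    exact (analyticAt_of_mem_holomorphicForms hρ hf hw).eventually_eq_zero_or_eventually_ne_zero

/-- There are no nonzero holomorphic differentials of negative weight. -/
theorem eq_zero_of_mem_holomorphicForms_neg (hg : 0 < g) (hρ : S.IsPoincareMetric ρ) (hn : n ≠ 0)
    (hf : f ∈ S.holomorphicForms (-(n : ℤ))) {z : ℂ} (hz : z ∈ S.domain) : f z = 0 := by
  -- Identity theorem: the points with vanishing germ form an open, relatively closed set containing
  -- ∞, so no covering of Ω₀ by translates of the region is needed.
  have hsub : S.sphereDomain ⊆ {w : OnePoint ℂ | ∀ᶠ v in 𝓝 w, v.elim 0 f = 0} := by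
    refine hρ.isPreconnected_sphereDomain.subset_of_closure_inter_subset ?_ ?_ ?_
    · rw [isOpen_iff_eventually]
      exact fun w hw => hw.eventually_nhds
    · refine ⟨OnePoint.infty, S.closedRegion_subset_sphereDomain S.infty_mem_closedRegion, ?_⟩
      rw [Set.mem_ofPred_eq, OnePoint.nhds_infty_eq, eventually_sup, eventually_map,
        eventually_pure, coclosedCompact_eq_cocompact, ← Metric.cobounded_eq_cocompact]
      exact ⟨S.eventually_cobounded_mem_finiteRegion.mono fun z hz =>
        eq_zero_on_finiteRegion hg hρ hn hf hz, rfl⟩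
    · rintro w ⟨hwcl, hw⟩
      rcases eventually_eq_zero_or_ne_zero hg hρ hf hw with h | h
      · exact h
      · by_contra hwu
        refine mem_closure_iff_frequently.1 hwcl ?_
        rw [eventually_nhdsWithin_iff] at h
        filter_upwards [h] with v hv hvu
        by_cases hvw : v = w
        · exact hwu (hvw ▸ hvu)
        · exact hv hvw (show ∀ᶠ v in 𝓝 v, v.elim 0 f = 0 from hvu).self_of_nhds
  exact (hsub hz).self_of_nhds

/-! ### The difference of two Green's functions as a form of weight 1 − N. -/

theorem exists_differentiableAt_sub_eq (hg : 0 < g) (hρ : S.IsPoincareMetric ρ)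
    {N : ℕ} {G G' : ℂ → ℂ → ℂ} (hG : S.IsGreenFunction ρ N G) (hG' : S.IsGreenFunction ρ N G') :
    ∃ h : ℂ → ℂ → ℂ, ∀ x y, S.RegularPair x y → DifferentiableAt ℂ (h x) y ∧
      (x ≠ y → G x y - G' x y = h x y) := by
  obtain ⟨p, GR, hp, hGR, -, hdiff⟩ := hG.regular_part
  obtain ⟨p', GR', hp', hGR', -, hdiff'⟩ := hG'.regular_part
  refine ⟨fun x y => GR x y - GR' x y, fun x y hxy => ⟨?_, fun hne => ?_⟩⟩
  · obtain ⟨h1, h2⟩ := hdiff x y hxy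
    obtain ⟨h1', h2'⟩ := hdiff' x y hxy
    rw [differentiableAt_complex_iff_differentiableAt_real]
    refine ⟨h1.sub h1', ?_⟩
    have hpi : (1 / (Real.pi : ℂ)) ≠ 0 :=
      one_div_ne_zero (Complex.ofReal_ne_zero.2 Real.pi_ne_zero)
    have h3 : wirtingerBar (fun y' => GR x y') y = wirtingerBar (fun y' => GR' x y') y := by
      refine mul_left_cancel₀ hpi ?_
      rw [h2, h2', hp.eq hg hρ hp' hxy.1 hxy.2.1]
    simp only [wirtingerBar] at h3
    rw [fderiv_fun_sub h1 h1', sub_apply, sub_apply, smul_eq_mul]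
    -- Equal ∂̄-derivatives are the Cauchy–Riemann equation for the difference.
    linear_combination (-2 * Complex.I) * h3 + (fderiv ℝ (fun y' => GR x y') y Complex.I -
      fderiv ℝ (fun y' => GR' x y') y Complex.I) * Complex.I_sq
  · simp only [hGR x y hxy hne, hGR' x y hxy hne]
    ring

end SchottkyGroup

/-- Lets the punctured limit of D serve as one global extension, whatever local extension is chosen.
-/
theorem eventuallyEq_limUnder_nhdsNE {D h : ℂ → ℂ} {y : ℂ}
    (hh : ∀ᶠ z in 𝓝 y, ContinuousAt h z) (hD : D =ᶠ[𝓝[≠] y] h) :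
    ∀ᶠ z in 𝓝 y, Tendsto D (𝓝[≠] z) (𝓝 (h z)) ∧ limUnder (𝓝[≠] z) D = h z := by
  have hD' := (eventually_nhdsWithin_iff.1 hD).eventually_nhds
  filter_upwards [hh, hD'] with z hz hDz
  have heq : D =ᶠ[𝓝[≠] z] h := by
    by_cases hzy : z = y
    · exact hzy ▸ hD
    · filter_upwards [hDz.filter_mono nhdsWithin_le_nhds,
        (eventually_ne_nhds hzy).filter_mono nhdsWithin_le_nhds] with v h1 h2 using h1 h2
  have hlim : Tendsto D (𝓝[≠] z) (𝓝 (h z)) :=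
    (hz.tendsto.mono_left nhdsWithin_le_nhds).congr' heq.symm
  exact ⟨hlim, hlim.limUnder_eq⟩

namespace SchottkyGroup

variable {g : ℕ} {S : SchottkyGroup g} {ρ : ℂ → ℝ}

theorem moebiusMap_tendsto_nhdsNE {γ : SL(2, ℂ)} {z : ℂ} (hd : moebiusDenom γ z ≠ 0) :
    Tendsto (moebiusMap γ) (𝓝[≠] z) (𝓝[≠] (moebiusMap γ z)) := by
  refine tendsto_nhdsWithin_iff.2
    ⟨(differentiableAt_moebiusMap hd).continuousAt.tendsto.mono_left nhdsWithin_le_nhds, ?_⟩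
  filter_upwards [(eventually_moebiusDenom_ne hd).filter_mono nhdsWithin_le_nhds,
    self_mem_nhdsWithin] with v hv hne heq
  refine hne (OnePoint.coe_injective (sphereMap_injective γ ?_))
  rw [sphereMap_coe_of_ne hv, sphereMap_coe_of_ne hd, heq]

/-- The difference of two Green's functions extends holomorphically over the orbit of `x`. -/
theorem exists_local_extension (hg : 0 < g) (hρ : S.IsPoincareMetric ρ)
    {N : ℕ} {G G' : ℂ → ℂ → ℂ} (hG : S.IsGreenFunction ρ N G) (hG' : S.IsGreenFunction ρ N G')
    {x y : ℂ} (hx : x ∈ S.domain) (hy : y ∈ S.domain) :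
    ∃ h : ℂ → ℂ, (∀ᶠ z in 𝓝 y, DifferentiableAt ℂ h z) ∧
      (∀ᶠ z in 𝓝[≠] y, G x z - G' x z = h z) ∧ (S.OffOrbit x y → G x y - G' x y = h y) := by
  obtain ⟨h, hh⟩ := exists_differentiableAt_sub_eq hg hρ hG hG'
  by_cases hxy : S.OffOrbit x y
  · have hreg := (hxy.regularPair hx hy).eventually hρ.isOpen_domain
    refine ⟨h x, hreg.mono fun z hz => (hh x z hz).1, ?_,
      fun _ => (hh x y (hxy.regularPair hx hy)).2 hxy.ne⟩
    filter_upwards [hreg.filter_mono nhdsWithin_le_nhds,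
      (S.eventually_offOrbit hy hxy).filter_mono nhdsWithin_le_nhds] with z h1 h2
      using (hh x z h1).2 h2.ne
  -- Here y = γx, and (x, y) need not be a regular pair. Automorphy in y under γ⁻¹ moves the
  -- question to (x, x), which is regular.
  · simp only [OffOrbit, not_forall, not_not] at hxy
    obtain ⟨γ, hγ, hγx⟩ := hxy
    have hγy : sphereMap γ⁻¹ y = (x : OnePoint ℂ) := by
      rw [← hγx, sphereMap_inv_apply]
    obtain ⟨hd, hmap⟩ := moebiusDenom_ne_zero_of_sphereMap_eq hγy
    have hγ' := S.group.inv_mem hγ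
    have hden := eventually_moebiusDenom_ne hd
    have hreg : ∀ᶠ z in 𝓝 y, S.RegularPair x (moebiusMap γ⁻¹ z) := by
      have h1 := (differentiableAt_moebiusMap hd).continuousAt
      rw [ContinuousAt, hmap] at h1
      exact h1.eventually ((S.regularPair_self hx).eventually hρ.isOpen_domain)
    refine ⟨fun z => h x (moebiusMap γ⁻¹ z) * moebiusDenom γ⁻¹ z ^ (-2 * (1 - (N : ℤ))), ?_, ?_,
      fun hoff => absurd hγx (hoff γ hγ)⟩
    · filter_upwards [hden, hreg] with z h1 h2
      exact ((hh x _ h2).1.comp z (differentiableAt_moebiusMap h1)).mul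
        ((differentiable_moebiusDenom _ z).zpow (Or.inl h1))
    · filter_upwards [hden.filter_mono nhdsWithin_le_nhds, hreg.filter_mono nhdsWithin_le_nhds,
        S.eventually_nhdsNE_offOrbit x hy,
        (hρ.isOpen_domain.eventually_mem hy).filter_mono nhdsWithin_le_nhds] with z h1 h2 h3 h4
      have hne : x ≠ moebiusMap γ⁻¹ z := by
        intro heq
        apply h3 γ hγ
        rw [heq, ← sphereMap_coe_of_ne h1, sphereMap_apply_inv]
      rw [← (hh x _ h2).2 hne, ← hG.form_right _ hγ' x hx z h4 h3 h1,
        ← hG'.form_right _ hγ' x hx z h4 h3 h1, sub_mul]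

theorem exists_holomorphicForm_eq_sub (hg : 0 < g) (hρ : S.IsPoincareMetric ρ)
    {N : ℕ} {G G' : ℂ → ℂ → ℂ} (hG : S.IsGreenFunction ρ N G) (hG' : S.IsGreenFunction ρ N G')
    {x : ℂ} (hx : x ∈ S.domain) :
    ∃ f ∈ S.holomorphicForms (1 - N), ∀ y ∈ S.domain, S.OffOrbit x y → G x y - G' x y = f y := by
  classical
  set D : ℂ → ℂ := fun z => G x z - G' x z with hD
  set f : ℂ → ℂ := fun y => if y ∈ S.domain then limUnder (𝓝[≠] y) D else 0 with hf
  have hloc : ∀ y ∈ S.domain, ∃ h : ℂ → ℂ, DifferentiableAt ℂ h y ∧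
      (∀ᶠ z in 𝓝 y, Tendsto D (𝓝[≠] z) (𝓝 (h z)) ∧ f z = h z) ∧
      (S.OffOrbit x y → D y = h y) := by
    intro y hy
    obtain ⟨h, h1, h2, h3⟩ := exists_local_extension hg hρ hG hG' hx hy
    refine ⟨h, h1.self_of_nhds, ?_, h3⟩
    filter_upwards [eventuallyEq_limUnder_nhdsNE (h1.mono fun z hz => hz.continuousAt) h2,
      hρ.isOpen_domain.eventually_mem hy] with z h4 h5
    refine ⟨h4.1, ?_⟩
    simp only [hf, if_pos h5]
    exact h4.2
  have hlim : ∀ y ∈ S.domain, Tendsto D (𝓝[≠] y) (𝓝 (f y)) := by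
    intro y hy
    obtain ⟨h, -, h2, -⟩ := hloc y hy
    rw [h2.self_of_nhds.2]
    exact h2.self_of_nhds.1
  refine ⟨f, ⟨fun y hy => ?_, fun γ hγ y hy hd => ?_, fun y hy => if_neg hy⟩, fun y hy hxy => ?_⟩
  · obtain ⟨h, h1, h2, -⟩ := hloc y hy
    exact h1.congr_of_eventuallyEq (h2.mono fun z hz => hz.2)
  · have h1 := (hlim _ (S.moebiusMap_mem_domain hγ hy hd)).comp (moebiusMap_tendsto_nhdsNE hd)
    have h2 : Tendsto (fun z => moebiusDenom γ z ^ (-2 * (1 - (N : ℤ)))) (𝓝[≠] y)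
        (𝓝 (moebiusDenom γ y ^ (-2 * (1 - (N : ℤ))))) :=
      ((differentiable_moebiusDenom γ y).zpow (Or.inl hd)).continuousAt.tendsto.mono_left
        nhdsWithin_le_nhds
    -- Automorphy holds off the orbit of x, hence on a punctured neighbourhood, and passes to the
    -- limit.
    refine tendsto_nhds_unique ((h1.mul h2).congr' ?_) (hlim y hy)
    filter_upwards [(eventually_moebiusDenom_ne hd).filter_mono nhdsWithin_le_nhds,
      S.eventually_nhdsNE_offOrbit x hy,
      (hρ.isOpen_domain.eventually_mem hy).filter_mono nhdsWithin_le_nhds] with z h3 h4 h5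
    simp only [hD, Function.comp_apply]
    rw [← hG.form_right γ hγ x hx z h5 h4 h3, ← hG'.form_right γ hγ x hx z h5 h4 h3, sub_mul]
  · obtain ⟨h, -, h2, h3⟩ := hloc y hy
    rw [h2.self_of_nhds.2]
    exact h3 hxy

end SchottkyGroup

end

theorem mainTheorem10 (g N : ℕ) (hg : 2 ≤ g) (hN : 2 ≤ N) (S : SchottkyGroup g)
    (ρ : ℂ → ℝ) (hρ : S.IsPoincareMetric ρ) (G G' : ℂ → ℂ → ℂ)
    (hG : S.IsGreenFunction ρ N G) (hG' : S.IsGreenFunction ρ N G') :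
    ∀ x ∈ S.domain, ∀ y ∈ S.domain, S.OffOrbit x y → G x y = G' x y := by
  intro x hx y hy hxy
  have hg0 : 0 < g := by lia
  obtain ⟨f, hf, hfG⟩ := SchottkyGroup.exists_holomorphicForm_eq_sub hg0 hρ hG hG' hx
  -- N ≥ 2 makes the truncated subtraction exact and the weight strictly negative.
  have hweight : (1 - N : ℤ) = -((N - 1 : ℕ) : ℤ) := by lia
  rw [hweight] at hf
  rw [← sub_eq_zero, hfG y hy hxy]
  exact SchottkyGroup.eq_zero_of_mem_holomorphicForms_neg hg0 hρ (by lia) hf hy
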